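/- Let $q\in\mathbb C\setminus\{0\}$ be such that $q$ is not a nontrivial root of unity (i.e. $q^n=1$ with $n\ge1$ only if $q=1$; the physical case is $|q|=1$). Put $\lambda=q-q^{-1}$, $[n]_q=\frac{q^n-q^{-n}}{q-q^{-1}}$ (with $[n]_1=n$), $[n]_q!=[n]_q\cdots[1]_q$, $[0]_q!=1$, and $1/\Gamma_q(p)=1/[p-1]_q!$ for integers $p\ge1$, $1/\Gamma_q(p)=0$ for integers $p\le0$. **Setting.** The momenta $k_v,k_-,k_+,k_{\bar v}$ generate the unital associative $\mathbb C$-algebra with relations $$k_\pm k_v=q^{\pm1}k_vk_\pm,\quad k_\pm k_{\bar v}=q^{\pm1}k_{\bar v}k_\pm,\quad k_+k_--k_-k_+=\lambda k_vk_{\bar v},\quad k_{\bar v}k_v=k_vk_{\bar v},\quad k_+k_-=q\,k_vk_{\bar v}$$ (the last one is the q-cone). Fields are formal power series in the normally ordered monomials $\bar v^m x_+^\ell x_-^n v^j$ of q-Minkowski space-time, in the commuting variables $z,\bar z$, and in the momenta (completed by degree); momenta commute with the coordinates and with $z,\bar z$. Infinite sums converge coefficientwise. For $\kappa\in\{v,-,+,\bar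 v,z,\bar z\}$ the following operators act on the basis monomials, hence commute for different $\kappa$: $N_\kappa$ is multiplication by the exponent of the variable $\kappa$, $T_\kappa=q^{N_\kappa}$, $\hat M_\kappa$ raises this exponent by one, and $\hat{\mathcal D}_\kappa=\lambda^{-1}\hat M_\kappa^{-1}(T_\kappa-T_\kappa^{-1})$, i.e. it multiplies by $[N_\kappa]_q$ and lowers the exponent by one. The homogeneous q-Maxwell equations are ${}_qI^+_0F^+=0$, ${}_qI^-_0F^-=0$ where $${}_qI^+_n=\tfrac12q\bigl(\hat{\mathcal D}_v+\hat M_{\bar z}\hat{\mathcal D}_+T_-T_{\bar v}^{-1}T_v\bigr)T_v[n+2-N_z]_q-\tfrac12q^{n+3}\bigl(\hat{\mathcal D}_-+\hat M_{\bar z}\hat{\mathcal D}_{\bar v}T_-+\lambda q^{-1}\hat M_v\hat M_{\bar z}\hat{\mathcal D}_-\hat{\mathcal D}_+T_{\bar v}^{-1}T_-\bigr)\hat{\mathcal D}_zT_-T_v,$$ $${}_qI^-_n=\tfrac12\Bigl(\bigl(\hat{\mathcal D}_{\bar v}T_{\bar v}T_-+\hat M_z\hat{\mathcal D}_+T_v+q^{-1}\lambda\hat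 M_v\hat{\mathcal D}_-\hat{\mathcal D}_+T_-\bigr)[n+2-N_{\bar z}]_q-q^{-n-2}\bigl(\hat{\mathcal D}_-+\hat M_z\hat{\mathcal D}_vT_-^{-1}\bigr)\hat{\mathcal D}_{\bar z}T_{\bar v}\Bigr)T_+T_{\bar z}T_z^{-1}.$$ The conjugate q-plane wave is $\widetilde{\exp}_q(k,x)=\sum_{s\ge0}\frac1{[s]_q!}\tilde h_s$ with $$\tilde h_s=\tilde\beta^s\sum_{a,b,n\ge0}\frac{(-1)^{s-a-b}q^{n(2a+2b-2n-s)+a(a-s-1)+b(s-a-b+1)}}{\Gamma_q(a-n+1)\Gamma_q(b-n+1)\Gamma_q(s-a-b+n+1)[n]_q!}\,k_{\bar v}^nk_+^{a-n}k_-^{b-n}k_v^{s-a-b+n}\;\bar v^{s-a-b+n}x_+^{b-n}x_-^{a-n}v^n,$$ $$(\tilde\beta^s)^{-1}=\sum_{p=0}^s\frac{q^{(p-s)(p-1)+p}}{[p]_q!\,[s-p]_q!}$$ ($\tilde\beta^s:=0$ should the last sum vanish). **Statement.** (1) For all complex constants $\tilde p^{ms1}_{ij},\tilde p^{ms2}_i,\tilde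 p^{ms3}_{ij}$ the series $\tilde F^{h+}=\sum_{m,s\ge0}\frac1{[s]_q!}\tilde F^{h+}_{ms}(k)\tilde h_s$ converges and ${}_qI^+_0\tilde F^{h+}=0$, where $$\tilde F^{h+}_{ms}(k)=\sum_{i=0}^m\Bigl(\sum_{j=0}^{m-i}\tilde p^{ms1}_{ij}k_{\bar v}^ik_-^{m-i-j}k_v^j(k_v-zk_-)(k_v-qzk_-)+\tilde p^{ms2}_ik_{\bar v}^ik_v^{m-i}(k_+-zk_{\bar v})(k_v-qzk_-)+\sum_{j=0}^{m-i}\tilde p^{ms3}_{ij}k_{\bar v}^ik_+^{m-i-j}k_v^j(k_+-zk_{\bar v})(k_+-qzk_{\bar v})\Bigr).$$ (2) For all complex constants $\tilde r^{ms1}_{ij},\tilde r^{ms2}_i,\tilde r^{ms3}_{ij}$ the series $\tilde F^{h-}=\sum_{m,s\ge0}\frac1{[s]_q!}\tilde F^{h-}_{ms}(k)\tilde h_s$ converges and ${}_qI^-_0\tilde F^{h-}=0$, where $$\tilde F^{h-}_{ms}(k)=\sum_{i=0}^m\Bigl(\sum_{j=0}^{m-i}\tilde r^{ms1}_{ij}k_{\bar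 v}^ik_-^{m-i-j}k_v^j(k_{\bar v}-q^{s+5}\bar zk_-)(k_{\bar v}-q^{s+2}\bar zk_-)+\tilde r^{ms2}_ik_v^ik_{\bar v}^{m-i}(k_{\bar v}-q^{s+5}\bar zk_-)(k_+-q^{s+2}\bar zk_v)+\sum_{j=0}^{m-i}\tilde r^{ms3}_{ij}k_v^ik_+^{m-i-j}k_{\bar v}^j(k_+-q^{s+5}\bar zk_v)(k_+-q^{s+2}\bar zk_v)\Bigr).$$ (3) The constants are independent: if no sum $(\tilde\beta^s)^{-1}$ vanishes, then $\tilde F^{h+}$ determines all the constants $\tilde p$ (those with $i+j\le m$, resp. $i\le m$) and $\tilde F^{h-}$ determines all the constants $\tilde r$. (4) If the constants $\tilde p$ do not depend on $s$, so that $\tilde F^{h+}_{ms}(k)=\tilde F^{h+}_m(k)$ for all $s$, then the series $\widetilde{\exp}_q(k,x)$ and $\sum_m\tilde F^{h+}_m(k)$ converge and $\tilde F^{h+}=\sum_m\bigl(\tilde F^{h+}_m(k)\,\widetilde{\exp}_q(k,x)\bigr)=\bigl(\sum_m\tilde F^{h+}_m(k)\bigr)\widetilde{\exp}_q(k,x)$.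 -/

import Mathlib

open scoped MvPowerSeries.WithPiTopology

noncomputable section

namespace QMaxwell

/-! ### q-numbers -/

/-- `[n]_q = (q ^ n - q ^ (-n)) / (q - q ^ (-1))`, with its limit value `n` at `q = 1`. -/
def qInt (q : ℂ) (n : ℤ) : ℂ :=
  if q = 1 then (n : ℂ) else (q ^ n - q ^ (-n)) / (q - q⁻¹)

/-- `[n]_q! = [n]_q [n-1]_q ⋯ [1]_q`, `[0]_q! = 1`. -/
def qFactorial (q : ℂ) (n : ℕ) : ℂ :=
  ∏ i ∈ Finset.range n, qInt q ((i : ℤ) + 1)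

/-- `1 / Γ_q(p)`: equal to `1 / [p-1]_q!` for `p ≥ 1`, and to `0` for integers `p ≤ 0`. -/
def invGamma (q : ℂ) (p : ℤ) : ℂ :=
  if 1 ≤ p then (qFactorial q (p - 1).toNat)⁻¹ else 0

/-- `λ = q - q⁻¹`. -/
def lam (q : ℂ) : ℂ := q - q⁻¹

/-! ### The momenta -/

/-- The four light-cone directions `v`, `-`, `+`, `v̄`. -/
inductive Dir : Type
  | v | m | p | b

/-- The free generators of the momentum algebra. -/
abbrev freeMom (κ : Dir) : FreeAlgebra ℂ Dir := FreeAlgebra.ι ℂ κ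

/-- The relations between the momenta: those of the q-Minkowski coordinates,
`k_± k_v = q^{±1} k_v k_±`, `k_± k_v̄ = q^{±1} k_v̄ k_±`, `k_+ k_- - k_- k_+ = λ k_v k_v̄`,
`k_v̄ k_v = k_v k_v̄`, together with the equation
`k_+ k_- - q k_v k_v̄ = 0` of the momentum q-cone
(equivalently, `k_- k_+ - q⁻¹ k_v k_v̄ = 0`). -/
inductive MomRel (q : ℂ) : FreeAlgebra ℂ Dir → FreeAlgebra ℂ Dir → Prop
  | plus_v : MomRel q (freeMom .p * freeMom .v) (q • (freeMom .v * freeMom .p))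
  | minus_v : MomRel q (freeMom .m * freeMom .v) (q⁻¹ • (freeMom .v * freeMom .m))
  | plus_b : MomRel q (freeMom .p * freeMom .b) (q • (freeMom .b * freeMom .p))
  | minus_b : MomRel q (freeMom .m * freeMom .b) (q⁻¹ • (freeMom .b * freeMom .m))
  | plus_minus : MomRel q (freeMom .p * freeMom .m - freeMom .m * freeMom .p)
      (lam q • (freeMom .v * freeMom .b))
  | b_v : MomRel q (freeMom .b * freeMom .v) (freeMom .v * freeMom .b)
  | cone : MomRel q (freeMom .p * freeMom .m - q • (freeMom .v * freeMom .b)) 0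

/-- The algebra of the noncommuting momenta on the q-cone. -/
abbrev Mom (q : ℂ) : Type := RingQuot (MomRel q)

/-- The generator of `Mom q` in the direction `κ`. -/
def mom (q : ℂ) (κ : Dir) : Mom q := RingQuot.mkAlgHom ℂ (MomRel q) (freeMom κ)

/-- The momentum algebra is discrete; infinite sums of formal series converge coefficientwise. -/
instance instTopologicalSpaceMom (q : ℂ) : TopologicalSpace (Mom q) := ⊥

instance instDiscreteTopologyMom (q : ℂ) : DiscreteTopology (Mom q) := ⟨rfl⟩

/-! ### Fields -/

/-- The commuting variables of a field: the q-Minkowski coordinates `x κ`, the spin variables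
`z` and `zb` (for `z̄`), and a variable `t` that records the degree in the momenta. -/
inductive Var : Type
  | x (κ : Dir) | z | zb | t

/-- Formal power series in the coordinates `v, x_-, x_+, v̄`, in `z, z̄` and in the momenta.

A monomial with exponents `j, n, ℓ, m` in `x v, x -, x +, x v̄` stands for the normally ordered
monomial `v̄^m x_+^ℓ x_-^n v^j` of q-Minkowski space-time; all the operators below are defined on
these basis monomials. The momenta do not commute with one another, but commute with all these
variables. As the relations of `Mom q` are homogeneous, a formal power series in the momenta is
a family of elements of `Mom q`, one for each degree `d`; the component of degree `d` is kept as
the coefficient of `t ^ d`. -/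
abbrev Field (q : ℂ) : Type := MvPowerSeries Var (Mom q)

/-- The momentum `k_κ` as a formal series: it has degree one. -/
def k (q : ℂ) (κ : Dir) : Field q := MvPowerSeries.X Var.t * MvPowerSeries.C (mom q κ)

/-- The variables as formal series. -/
def var (q : ℂ) (κ : Var) : Field q := MvPowerSeries.X κ

/-! ### q-difference operators -/

/-- The operator that multiplies the monomial with exponents `e` by the number `c e`. -/
def diagOp (q : ℂ) (c : (Var →₀ ℕ) → ℂ) : Module.End ℂ (Field q) where
  toFun f := fun e => c e • MvPowerSeries.coeff e f
  map_add' f g := by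
    funext e
    exact (congrArg (c e • ·) (map_add (MvPowerSeries.coeff e) f g)).trans (smul_add _ _ _)
  map_smul' a f := by
    funext e
    exact smul_comm (c e) a (MvPowerSeries.coeff e f)

/-- `T_κ = q^{N_κ}`. -/
def T (q : ℂ) (κ : Var) : Module.End ℂ (Field q) := diagOp q fun e => q ^ e κ

/-- `T_κ⁻¹ = q^{-N_κ}`. -/
def Tinv (q : ℂ) (κ : Var) : Module.End ℂ (Field q) := diagOp q fun e => (q ^ e κ)⁻¹

/-- `[c - N_κ]_q`. -/
def qIntSub (q : ℂ) (c : ℤ) (κ : Var) : Module.End ℂ (Field q) :=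
  diagOp q fun e => qInt q (c - (e κ : ℤ))

/-- `M̂_κ`, which raises the exponent of the variable `κ` by one. -/
def M (q : ℂ) (κ : Var) : Module.End ℂ (Field q) := LinearMap.mulLeft ℂ (var q κ)

/-- The q-difference operator `D̂_κ = λ⁻¹ M̂_κ⁻¹ (T_κ - T_κ⁻¹)`: it multiplies a monomial by
`[n]_q`, where `n` is the exponent of the variable `κ`, and lowers this exponent by one. -/
def D (q : ℂ) (κ : Var) : Module.End ℂ (Field q) where
  toFun f := fun e =>
    qInt q ((e κ : ℤ) + 1) • MvPowerSeries.coeff (e + Finsupp.single κ 1) f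
  map_add' f g := by
    funext e
    exact (congrArg (qInt q ((e κ : ℤ) + 1) • ·)
      (map_add (MvPowerSeries.coeff (e + Finsupp.single κ 1)) f g)).trans (smul_add _ _ _)
  map_smul' a f := by
    funext e
    exact smul_comm (qInt q ((e κ : ℤ) + 1)) a
      (MvPowerSeries.coeff (e + Finsupp.single κ 1) f)

open Var Dir in
/-- The operator `_qI^+_n` in the basis `v̄^m x_+^ℓ x_-^n v^j`. -/
def maxwellPlus (q : ℂ) (n : ℤ) : Module.End ℂ (Field q) :=
  (1 / 2 * q) • ((D q (x v) + M q zb * D q (x p) * T q (x m) * Tinv q (x b) * T q (x v))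
      * T q (x v) * qIntSub q (n + 2) z)
  - (1 / 2 * q ^ (n + 3)) • ((D q (x m) + M q zb * D q (x b) * T q (x m)
      + (lam q * q⁻¹) • (M q (x v) * M q zb * D q (x m) * D q (x p)
          * Tinv q (x b) * T q (x m)))
      * D q z * T q (x m) * T q (x v))

open Var Dir in
/-- The operator `_qI^-_n` in the basis `v̄^m x_+^ℓ x_-^n v^j`. -/
def maxwellMinus (q : ℂ) (n : ℤ) : Module.End ℂ (Field q) :=
  (1 / 2 : ℂ) • (((D q (x b) * T q (x b) * T q (x m) + M q z * D q (x p) * T q (x v)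
        + (q⁻¹ * lam q) • (M q (x v) * D q (x m) * D q (x p) * T q (x m)))
        * qIntSub q (n + 2) zb
      - q ^ (-n - 2) • ((D q (x m) + M q z * D q (x v) * Tinv q (x m))
        * D q zb * T q (x b)))
    * T q (x p) * T q zb * Tinv q z)

/-! ### The conjugate q-plane wave -/

/-- The inverse of the normalization `β̃^s` (here `s` is an upper index, not a power). -/
def invBeta (q : ℂ) (s : ℕ) : ℂ :=
  ∑ p ∈ Finset.range (s + 1),
    q ^ (((p : ℤ) - s) * ((p : ℤ) - 1) + p) / (qFactorial q p * qFactorial q (s - p))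

open Var Dir in
/-- The component `h̃_s` of the conjugate q-plane wave, with `Q_s(a, b) = 0`. The factors
`1 / Γ_q` vanish unless `n ≤ a`, `n ≤ b` and `a + b ≤ s + n`, and then `a, b, n ≤ s`;
so the sum over all `a, b, n ≥ 0` is finite, and in its nonzero terms the exponents
written with a truncated subtraction are true differences. -/
def hTilde (q : ℂ) (s : ℕ) : Field q :=
  (invBeta q s)⁻¹ • ∑ a ∈ Finset.range (s + 1), ∑ b' ∈ Finset.range (s + 1),
    ∑ n ∈ Finset.range (s + 1),
      ((-1) ^ ((s : ℤ) - a - b')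
          * q ^ ((n : ℤ) * (2 * a + 2 * b' - 2 * n - s) + a * ((a : ℤ) - s - 1)
              + b' * ((s : ℤ) - a - b' + 1))
          * invGamma q ((a : ℤ) - n + 1) * invGamma q ((b' : ℤ) - n + 1)
          * invGamma q ((s : ℤ) - a - b' + n + 1) * (qFactorial q n)⁻¹) •
        (k q b ^ n * k q p ^ (a - n) * k q m ^ (b' - n) * k q v ^ (s + n - (a + b'))
          * (var q (x b) ^ (s + n - (a + b')) * var q (x p) ^ (b' - n)
            * var q (x m) ^ (a - n) * var q (x v) ^ n))

/-- The conjugate q-plane wave `∑_s h̃_s / [s]_q!`. -/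
def expTilde (q : ℂ) : Field q := ∑' s : ℕ, (qFactorial q s)⁻¹ • hTilde q s

/-! ### The solutions -/

/-- The constants that enter the coefficient polynomial with given `m` and `s`: those of its
first, second and third sum. Only the indices `i + j ≤ m`, resp. `i ≤ m`, are used. -/
structure Constants where
  c₁ : ℕ → ℕ → ℂ
  c₂ : ℕ → ℂ
  c₃ : ℕ → ℕ → ℂ

/-- Two sets of constants coincide in all the indices that are used for the given `m`. -/
def Constants.Agree (m : ℕ) (c c' : Constants) : Prop :=
  (∀ i j, i + j ≤ m → c.c₁ i j = c'.c₁ i j) ∧ (∀ i, i ≤ m → c.c₂ i = c'.c₂ i) ∧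
    (∀ i j, i + j ≤ m → c.c₃ i j = c'.c₃ i j)

open Dir in
/-- The coefficient `F̃^{h+}_{ms}(k)`; it depends on `s` through the constants only. -/
def coeffPlus (q : ℂ) (m : ℕ) (c : Constants) : Field q :=
  ∑ i ∈ Finset.range (m + 1),
    ((∑ j ∈ Finset.range (m - i + 1), c.c₁ i j •
        (k q b ^ i * k q Dir.m ^ (m - i - j) * k q v ^ j
          * (k q v - var q .z * k q Dir.m) * (k q v - q • (var q .z * k q Dir.m))))
      + c.c₂ i •
        (k q b ^ i * k q v ^ (m - i)
          * (k q p - var q .z * k q b) * (k q v - q • (var q .z * k q Dir.m)))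
      + ∑ j ∈ Finset.range (m - i + 1), c.c₃ i j •
        (k q b ^ i * k q p ^ (m - i - j) * k q v ^ j
          * (k q p - var q .z * k q b) * (k q p - q • (var q .z * k q b))))

open Dir in
/-- The coefficient `F̃^{h-}_{ms}(k)`. -/
def coeffMinus (q : ℂ) (m s : ℕ) (c : Constants) : Field q :=
  ∑ i ∈ Finset.range (m + 1),
    ((∑ j ∈ Finset.range (m - i + 1), c.c₁ i j •
        (k q b ^ i * k q Dir.m ^ (m - i - j) * k q v ^ j
          * (k q b - q ^ (s + 5) • (var q .zb * k q Dir.m))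
          * (k q b - q ^ (s + 2) • (var q .zb * k q Dir.m))))
      + c.c₂ i •
        (k q v ^ i * k q b ^ (m - i)
          * (k q b - q ^ (s + 5) • (var q .zb * k q Dir.m))
          * (k q p - q ^ (s + 2) • (var q .zb * k q v)))
      + ∑ j ∈ Finset.range (m - i + 1), c.c₃ i j •
        (k q v ^ i * k q p ^ (m - i - j) * k q b ^ j
          * (k q p - q ^ (s + 5) • (var q .zb * k q v))
          * (k q p - q ^ (s + 2) • (var q .zb * k q v))))

/-- The term of `F̃^{h+}` with indices `m, s`; `c m s` are the constants `p̃^{ms}`. -/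
def termPlus (q : ℂ) (c : ℕ → ℕ → Constants) (ms : ℕ × ℕ) : Field q :=
  (qFactorial q ms.2)⁻¹ • (coeffPlus q ms.1 (c ms.1 ms.2) * hTilde q ms.2)

/-- The term of `F̃^{h-}` with indices `m, s`; `c m s` are the constants `r̃^{ms}`. -/
def termMinus (q : ℂ) (c : ℕ → ℕ → Constants) (ms : ℕ × ℕ) : Field q :=
  (qFactorial q ms.2)⁻¹ • (coeffMinus q ms.1 ms.2 (c ms.1 ms.2) * hTilde q ms.2)

/-- `F̃^{h+}`. -/
def fieldPlus (q : ℂ) (c : ℕ → ℕ → Constants) : Field q := ∑' ms : ℕ × ℕ, termPlus q c ms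

/-- `F̃^{h-}`. -/
def fieldMinus (q : ℂ) (c : ℕ → ℕ → Constants) : Field q := ∑' ms : ℕ × ℕ, termMinus q c ms

end QMaxwell

end

/-! The coefficient of `v̄^a x_+^j x_-^l v^n` in `h̃_s` is a scalar times the single word `k_v̄^n
k_+^l k_-^j k_v^a`. Its scalar, `amp` up to normalization, has q-factorials in the denominator and a
power of q whose exponent is affine in each index separately. Each q-derivative of `h̃_s` therefore
has the same scalar times an explicit power of q, with one letter added to the word. The
second-order term carrying `λ` also collapses to this shape, because `λ [n]_q = q^n - q^(-n)` and
the q-cone turns `k_+ k_-` into `k_v k_v̄`. Comparing words gives eight first-order relations such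
as `k_v (D_v T_v h̃_s) = -q² k_- (D_- T_- T_v h̃_s)`. In the minus case the factor is `-q^(s+2)`.

Each summand of the coefficient polynomials is `Q (α - ρ z γ)(α' - σ z γ')`, with `γ α' = q⁻¹ α γ'`.
On polynomials of degree at most two in the spin variable a Maxwell operator reduces to four
equations between consecutive spin coefficients. The first-order relations reduce these to two
scalar identities, which the given `ρ` and `σ` satisfy (`maxwellPlus_product`,
`maxwellMinus_product`).

The term with indices `m, s` is homogeneous of degree `m + 2 + s` in the momenta, so only finitely
many terms meet a given coefficient. The operators are continuous and pass through the sum.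
Constants independent of `s` allow the double sum to be taken over `s` first, which produces the
plane wave.

For independence, the coefficient of `v̄^s` in momentum degree `m + 2 + s` isolates the pair `(m,
s)`, and only the leading words `Q α α' k_v^s` survive in it. The momenta act on functions on `ℤ³`
by weighted translations with nonzero weights. The leading words translate by distinct vectors, so
they are linearly independent (`agree_of_combine_eq`). -/

noncomputable section

namespace QMaxwell

/-! ### q-numbers -/

section QNumbers

variable {q : ℂ}

/-- `q` is not a nontrivial root of unity. -/
def NonRoot (q : ℂ) : Prop := ∀ n : ℕ, 0 < n → q ^ n = 1 → q = 1

theorem lam_ne_zero (hq₀ : q ≠ 0) (hq : NonRoot q) (h1 : q ≠ 1) : lam q ≠ 0 := by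
  intro h
  apply h1
  -- `λ = 0` means `q² = 1`.
  apply hq 2 (by norm_num)
  unfold lam at h
  field_simp at h
  linear_combination h

/-- At `q = 1` both sides vanish, so this division-free form needs no case distinction when it is
used. -/
theorem lam_mul_qInt (hq₀ : q ≠ 0) (hq : NonRoot q) (n : ℤ) :
    lam q * qInt q n = q ^ n - q ^ (-n) := by
  unfold qInt
  split_ifs with h
  · subst h; simp [lam]
  · have := lam_ne_zero hq₀ hq h
    exact mul_div_cancel₀ _ this

theorem qInt_zero : qInt q 0 = 0 := by
  unfold qInt; split_ifs <;> simp

theorem qInt_one (hq₀ : q ≠ 0) (hq : NonRoot q) : qInt q 1 = 1 := by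
  unfold qInt
  split_ifs with h
  · simp
  · have := lam_ne_zero hq₀ hq h
    unfold lam at this
    simpa using div_self this

theorem qInt_two (hq₀ : q ≠ 0) (hq : NonRoot q) : qInt q 2 = q + q⁻¹ := by
  unfold qInt
  split_ifs with h
  · subst h; norm_num
  · have := lam_ne_zero hq₀ hq h
    unfold lam at this
    rw [div_eq_iff this, zpow_neg]
    norm_cast
    field_simp
    ring

theorem qInt_natCast_ne_zero (hq₀ : q ≠ 0) (hq : NonRoot q) {n : ℕ} (hn : 0 < n) :
    qInt q n ≠ 0 := by
  intro h
  by_cases h1 : q = 1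
  · simp [qInt, h1] at h; omega
  · apply h1
    -- `[n]_q = 0` forces `q^n = q^(-n)`, that is `q^(2n) = 1`.
    apply hq (n + n) (by omega)
    have := lam_mul_qInt hq₀ hq n
    rw [h, mul_zero, zpow_neg, zpow_natCast, eq_comm, sub_eq_zero] at this
    rw [pow_add]
    nth_rw 1 [this]
    exact inv_mul_cancel₀ (pow_ne_zero _ hq₀)

theorem qInt_succ_ne_zero (hq₀ : q ≠ 0) (hq : NonRoot q) (n : ℕ) :
    qInt q ((n : ℤ) + 1) ≠ 0 := by
  exact_mod_cast qInt_natCast_ne_zero hq₀ hq n.succ_pos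

theorem qFactorial_succ (n : ℕ) :
    qFactorial q (n + 1) = qFactorial q n * qInt q ((n : ℤ) + 1) :=
  Finset.prod_range_succ _ _

theorem qFactorial_ne_zero (hq₀ : q ≠ 0) (hq : NonRoot q) (n : ℕ) : qFactorial q n ≠ 0 :=
  Finset.prod_ne_zero_iff.2 fun i _ => qInt_succ_ne_zero hq₀ hq i

theorem invGamma_natCast_add_one (n : ℕ) : invGamma q ((n : ℤ) + 1) = (qFactorial q n)⁻¹ := by
  simp [invGamma]

theorem invGamma_of_nonpos {p : ℤ} (h : p ≤ 0) : invGamma q p = 0 := by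
  rw [invGamma, if_neg (by omega)]

end QNumbers

/-! ### Words in the momenta -/

section Words

variable {q : ℂ}

theorem commute_up {R : Type*} [Ring R] [Algebra ℂ R] {x y : R} {c : ℂ} (h : x * y = c • (y * x))
    (n : ℕ) : x * y ^ n = c ^ n • (y ^ n * x) := by
  induction n with
  | zero => simp
  | succ n ih =>
    rw [pow_succ, ← mul_assoc, ih, smul_mul_assoc, mul_assoc, h, mul_smul_comm, smul_smul,
      pow_succ, mul_assoc]

theorem mom_rel {x y : FreeAlgebra ℂ Dir} (h : MomRel q x y) :
    RingQuot.mkAlgHom ℂ (MomRel q) x = RingQuot.mkAlgHom ℂ (MomRel q) y :=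
  RingQuot.mkAlgHom_rel ℂ h

theorem p_mul_v : mom q .p * mom q .v = q • (mom q .v * mom q .p) := by
  simpa [mom] using mom_rel (q := q) MomRel.plus_v

theorem m_mul_v : mom q .m * mom q .v = q⁻¹ • (mom q .v * mom q .m) := by
  simpa [mom] using mom_rel (q := q) MomRel.minus_v

theorem p_mul_b : mom q .p * mom q .b = q • (mom q .b * mom q .p) := by
  simpa [mom] using mom_rel (q := q) MomRel.plus_b

theorem m_mul_b : mom q .m * mom q .b = q⁻¹ • (mom q .b * mom q .m) := by
  simpa [mom] using mom_rel (q := q) MomRel.minus_b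

theorem b_mul_v : mom q .b * mom q .v = mom q .v * mom q .b := by
  simpa [mom] using mom_rel (q := q) MomRel.b_v

theorem p_mul_m : mom q .p * mom q .m = q • (mom q .v * mom q .b) := by
  have := mom_rel (q := q) MomRel.cone
  rw [map_sub, map_zero, sub_eq_zero] at this
  simpa [mom] using this

/-- Subtracting the commutator from the cone relation leaves the factor `q - λ = q⁻¹`. -/
theorem m_mul_p : mom q .m * mom q .p = q⁻¹ • (mom q .v * mom q .b) := by
  have := mom_rel (q := q) MomRel.plus_minus
  simp only [map_sub, map_mul, map_smul] at this
  change mom q .p * mom q .m - mom q .m * mom q .p = lam q • (mom q .v * mom q .b) at this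
  rw [p_mul_m, lam, sub_eq_iff_eq_add, ← sub_eq_iff_eq_add'] at this
  rw [← this]
  module

theorem v_mul_p (hq₀ : q ≠ 0) : mom q .v * mom q .p = q⁻¹ • (mom q .p * mom q .v) := by
  rw [p_mul_v, smul_smul, inv_mul_cancel₀ hq₀, one_smul]

theorem v_mul_m (hq₀ : q ≠ 0) : mom q .v * mom q .m = q • (mom q .m * mom q .v) := by
  rw [m_mul_v, smul_smul, mul_inv_cancel₀ hq₀, one_smul]

/-- On the cone both products are multiples of `k_v k_v̄`, so even `k_+` and `k_-` commute up to a
power of q. This makes every left multiplication of a word a scalar times a word. -/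
theorem m_mul_p' (hq₀ : q ≠ 0) :
    mom q .m * mom q .p = (q⁻¹ * q⁻¹) • (mom q .p * mom q .m) := by
  rw [m_mul_p, p_mul_m, smul_smul]
  congr 1
  field_simp

/-- The word `k_v̄^n k_+^ℓ k_-^j k_v^a`. -/
def word (q : ℂ) (n l j a : ℕ) : Mom q :=
  mom q .b ^ n * mom q .p ^ l * mom q .m ^ j * mom q .v ^ a

theorem b_mul_word (n l j a : ℕ) : mom q .b * word q n l j a = word q (n + 1) l j a := by
  simp only [word, pow_succ', mul_assoc]

theorem p_mul_word (n l j a : ℕ) :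
    mom q .p * word q n l j a = q ^ n • word q n (l + 1) j a := by
  simp only [word, ← mul_assoc]
  rw [commute_up p_mul_b]
  simp only [smul_mul_assoc, pow_succ', mul_assoc]

theorem m_mul_word (hq₀ : q ≠ 0) (n l j a : ℕ) :
    mom q .m * word q n l j a = ((q ^ n)⁻¹ * ((q ^ l)⁻¹ * (q ^ l)⁻¹)) • word q n l (j + 1) a := by
  simp only [word, ← mul_assoc]
  rw [commute_up m_mul_b, smul_mul_assoc, mul_assoc (mom q .b ^ n), commute_up (m_mul_p' hq₀)]
  simp only [smul_mul_assoc, mul_smul_comm, smul_smul, pow_succ', mul_assoc, mul_pow, inv_pow]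

theorem v_mul_word (hq₀ : q ≠ 0) (n l j a : ℕ) :
    mom q .v * word q n l j a = ((q ^ l)⁻¹ * q ^ j) • word q n l j (a + 1) := by
  have hb : Commute (mom q .v) (mom q .b) := b_mul_v.symm
  simp only [word, ← mul_assoc]
  rw [(hb.pow_right n).eq, mul_assoc (mom q .b ^ n), commute_up (v_mul_p hq₀)]
  simp only [smul_mul_assoc, mul_smul_comm, mul_assoc]
  rw [← mul_assoc (mom q .v), commute_up (v_mul_m hq₀)]
  simp only [smul_mul_assoc, mul_smul_comm, smul_smul, pow_succ', mul_assoc, inv_pow]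

/-- The cone relation replaces the inner `k_+ k_-` by `q k_v̄ k_v`. Moving `k_v̄` left through
`k_+^l` costs `q^l`, and moving `k_v` right through `k_-^j` costs `q^j`. -/
theorem word_reduce (hq₀ : q ≠ 0) (n l j a : ℕ) :
    word q n (l + 1) (j + 1) a = (q * (q ^ l * q ^ j)) • word q (n + 1) l j (a + 1) := by
  have hvb : mom q .v * mom q .b = mom q .b * mom q .v := b_mul_v.symm
  have h2 := commute_up (v_mul_m (q := q) hq₀) j
  have h3 : mom q .p ^ l * mom q .b = q ^ l • (mom q .b * mom q .p ^ l) := by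
    induction l with
    | zero => simp
    | succ l ih =>
      rw [pow_succ, mul_assoc, p_mul_b, mul_smul_comm, ← mul_assoc, ih, smul_mul_assoc, smul_smul,
        pow_succ', mul_assoc]
  calc word q n (l + 1) (j + 1) a
      = mom q .b ^ n * (mom q .p ^ l * ((mom q .p * mom q .m) * (mom q .m ^ j * mom q .v ^ a))) := by
        rw [word, pow_succ, pow_succ']; simp only [mul_assoc]
    _ = q • (mom q .b ^ n * ((mom q .p ^ l * mom q .b) * ((mom q .v * mom q .m ^ j)
          * mom q .v ^ a))) := by
        rw [p_mul_m, hvb]; simp only [smul_mul_assoc, mul_smul_comm, mul_assoc]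
    _ = _ := by
        rw [h2, h3, word, pow_succ, pow_succ', mul_comm (q ^ l)]
        simp only [smul_mul_assoc, mul_smul_comm, mul_assoc, smul_smul]

end Words

/-! ### The coefficients of the plane wave -/

section PlaneWave

variable {q : ℂ}

/-- The scalar factor in the coefficient of `v̄^a x_+^j x_-^l v^n` in the plane wave. -/
def amp (q : ℂ) (a j l n : ℕ) : ℂ :=
  (-1) ^ (a + n) * q ^ ((n : ℤ) * l - n * a - n * j - l * a - l * j + a * j - l + j)
    / (qFactorial q a * qFactorial q j * qFactorial q l * qFactorial q n)

theorem amp_ne_zero (hq₀ : q ≠ 0) (hq : NonRoot q) (a j l n : ℕ) : amp q a j l n ≠ 0 := by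
  have := qFactorial_ne_zero hq₀ hq
  unfold amp
  simp [this, zpow_ne_zero, hq₀]

/-- The exponent of q in `amp` contains no squares, so raising one index changes it by a linear form
in the other three, up to a constant. The factor `[n+1]_q` cancels the new factor of the
q-factorial. The next three recursions have the same origin. -/
theorem amp_succ_v (hq₀ : q ≠ 0) (hq : NonRoot q) (a j l n : ℕ) :
    qInt q ((n : ℤ) + 1) * amp q a j l (n + 1)
      = -(q ^ l * (q ^ a)⁻¹ * (q ^ j)⁻¹) * amp q a j l n := by
  have h := qFactorial_ne_zero hq₀ hq
  have h1 := qInt_succ_ne_zero hq₀ hq n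
  have e : ((n + 1 : ℕ) : ℤ) * l - (n + 1 : ℕ) * a - (n + 1 : ℕ) * j - l * a - l * j + a * j - l + j
      = ((n : ℤ) * l - n * a - n * j - l * a - l * j + a * j - l + j) + (l - a - j) := by
    push_cast; ring
  unfold amp
  rw [e, zpow_add₀ hq₀, qFactorial_succ, zpow_sub₀ hq₀, zpow_sub₀ hq₀]
  simp only [zpow_natCast]
  field_simp [h a, h j, h l, h n]
  ring

theorem amp_succ_m (hq₀ : q ≠ 0) (hq : NonRoot q) (a j l n : ℕ) :
    qInt q ((l : ℤ) + 1) * amp q a j (l + 1) n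
      = (q ^ n * (q ^ a)⁻¹ * (q ^ j)⁻¹ * q⁻¹) * amp q a j l n := by
  have h := qFactorial_ne_zero hq₀ hq
  have h1 := qInt_succ_ne_zero hq₀ hq l
  have e : (n : ℤ) * (l + 1 : ℕ) - n * a - n * j - (l + 1 : ℕ) * a - (l + 1 : ℕ) * j + a * j
      - (l + 1 : ℕ) + j
      = ((n : ℤ) * l - n * a - n * j - l * a - l * j + a * j - l + j) + (n - a - j - 1) := by
    push_cast; ring
  unfold amp
  rw [e, zpow_add₀ hq₀, qFactorial_succ, zpow_sub₀ hq₀, zpow_sub₀ hq₀, zpow_sub₀ hq₀]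
  simp only [zpow_natCast, zpow_one]
  field_simp [h a, h j, h l, h n]

theorem amp_succ_p (hq₀ : q ≠ 0) (hq : NonRoot q) (a j l n : ℕ) :
    qInt q ((j : ℤ) + 1) * amp q a (j + 1) l n
      = ((q ^ n)⁻¹ * (q ^ l)⁻¹ * q ^ a * q) * amp q a j l n := by
  have h := qFactorial_ne_zero hq₀ hq
  have h1 := qInt_succ_ne_zero hq₀ hq j
  have e : (n : ℤ) * l - n * a - n * (j + 1 : ℕ) - l * a - l * (j + 1 : ℕ) + a * (j + 1 : ℕ) - l
      + (j + 1 : ℕ)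
      = ((n : ℤ) * l - n * a - n * j - l * a - l * j + a * j - l + j) + (a - n - l + 1) := by
    push_cast; ring
  unfold amp
  rw [e, zpow_add₀ hq₀, qFactorial_succ, show (a : ℤ) - n - l + 1 = a + 1 - n - l by ring,
    zpow_sub₀ hq₀ _ (l : ℤ), zpow_sub₀ hq₀ _ (n : ℤ), zpow_add₀ hq₀ (a : ℤ)]
  simp only [zpow_natCast, zpow_one]
  field_simp [h a, h j, h l, h n]

theorem amp_succ_b (hq₀ : q ≠ 0) (hq : NonRoot q) (a j l n : ℕ) :
    qInt q ((a : ℤ) + 1) * amp q (a + 1) j l n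
      = -((q ^ n)⁻¹ * (q ^ l)⁻¹ * q ^ j) * amp q a j l n := by
  have h := qFactorial_ne_zero hq₀ hq
  have h1 := qInt_succ_ne_zero hq₀ hq a
  have e : (n : ℤ) * l - n * (a + 1 : ℕ) - n * j - l * (a + 1 : ℕ) - l * j + (a + 1 : ℕ) * j - l
      + j
      = ((n : ℤ) * l - n * a - n * j - l * a - l * j + a * j - l + j) + (j - n - l) := by
    push_cast; ring
  unfold amp
  rw [e, zpow_add₀ hq₀, qFactorial_succ, zpow_sub₀ hq₀, zpow_sub₀ hq₀]
  simp only [zpow_natCast]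
  field_simp [h a, h j, h l, h n]
  ring

theorem coeff_const_smul (e : Var →₀ ℕ) (c : ℂ) (f : Field q) :
    MvPowerSeries.coeff e (c • f) = c • MvPowerSeries.coeff e f := rfl

open MvPowerSeries in
theorem k_pow (κ : Dir) (n : ℕ) :
    k q κ ^ n = monomial (Finsupp.single Var.t n) (mom q κ ^ n) := by
  have h : k q κ = monomial (Finsupp.single Var.t 1) (mom q κ) := by
    rw [k, X_def, ← monomial_zero_eq_C_apply, monomial_mul_monomial]; simp
  induction n with
  | zero => simp
  | succ n ih => rw [pow_succ, ih, h, monomial_mul_monomial, Finsupp.single_add, pow_succ]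

theorem Finsupp_var_ext {e e' : Var →₀ ℕ} :
    e = e' ↔ e (.x .b) = e' (.x .b) ∧ e (.x .p) = e' (.x .p) ∧ e (.x .m) = e' (.x .m) ∧
      e (.x .v) = e' (.x .v) ∧ e .z = e' .z ∧ e .zb = e' .zb ∧ e .t = e' .t := by
  constructor
  · rintro rfl; simp
  · rintro ⟨h1, h2, h3, h4, h5, h6, h7⟩
    ext κ
    rcases κ with (_ | _ | _ | _) | _ | _ | _ <;> assumption

/-- The exponents that occur in `h̃_s`. -/
def IsWaveExponent (s : ℕ) (e : Var →₀ ℕ) : Prop :=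
  e .z = 0 ∧ e .zb = 0 ∧ e .t = s ∧ e (.x .b) + e (.x .p) + e (.x .m) + e (.x .v) = s

open MvPowerSeries in
theorem coeff_waveMonomial (A B C n s : ℕ) (w : Mom q) (e : Var →₀ ℕ) :
    coeff e (monomial (Finsupp.single Var.t s) w
      * (var q (.x .b) ^ A * var q (.x .p) ^ B * var q (.x .m) ^ C * var q (.x .v) ^ n))
    = open Classical in if e .z = 0 ∧ e .zb = 0 ∧ e .t = s ∧ e (.x .b) = A ∧ e (.x .p) = B ∧
        e (.x .m) = C ∧ e (.x .v) = n then w else 0 := by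
  classical
  simp only [var, X_pow_eq, monomial_mul_monomial, mul_one, coeff_monomial, Finsupp_var_ext]
  simp only [Finsupp.add_apply, Finsupp.single_apply, reduceCtorEq, Var.x.injEq, if_true, if_false,
    add_zero, zero_add]
  congr 1
  apply propext
  tauto

-- The exponents determine the summation indices: `n = e_v`, `a = e_- + e_v` and `b = e_+ + e_v`. At
-- most one term of the triple sum thus contributes to a given coefficient.
open MvPowerSeries in
theorem coeff_hTilde (s : ℕ) (e : Var →₀ ℕ) :
    coeff e (hTilde q s) = open Classical in if IsWaveExponent s e then
      (invBeta q s)⁻¹ • (amp q (e (.x .b)) (e (.x .p)) (e (.x .m)) (e (.x .v))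
        • word q (e (.x .v)) (e (.x .m)) (e (.x .p)) (e (.x .b))) else 0 := by
  classical
  have key : ∀ a b' n : ℕ,
      coeff e (((-1) ^ ((s : ℤ) - a - b')
          * q ^ ((n : ℤ) * (2 * a + 2 * b' - 2 * n - s) + a * ((a : ℤ) - s - 1)
              + b' * ((s : ℤ) - a - b' + 1))
          * invGamma q ((a : ℤ) - n + 1) * invGamma q ((b' : ℤ) - n + 1)
          * invGamma q ((s : ℤ) - a - b' + n + 1) * (qFactorial q n)⁻¹) •
        (k q .b ^ n * k q .p ^ (a - n) * k q .m ^ (b' - n) * k q .v ^ (s + n - (a + b'))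
          * (var q (.x .b) ^ (s + n - (a + b')) * var q (.x .p) ^ (b' - n)
            * var q (.x .m) ^ (a - n) * var q (.x .v) ^ n)))
      = if IsWaveExponent s e ∧ a = e (.x .m) + e (.x .v) ∧ b' = e (.x .p) + e (.x .v)
          ∧ n = e (.x .v) then
        amp q (e (.x .b)) (e (.x .p)) (e (.x .m)) (e (.x .v))
        • word q (e (.x .v)) (e (.x .m)) (e (.x .p)) (e (.x .b)) else 0 := by
    intro a b' n
    -- Inside this range the truncated subtractions are true differences; outside it some factor `1
    -- / Γ_q` vanishes.
    by_cases hn : n ≤ a ∧ n ≤ b' ∧ a + b' ≤ s + n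
    · obtain ⟨h1, h2, h3⟩ := hn
      obtain ⟨C, rfl⟩ := Nat.exists_eq_add_of_le h1
      obtain ⟨B, rfl⟩ := Nat.exists_eq_add_of_le h2
      obtain ⟨A, hA⟩ := Nat.exists_eq_add_of_le h3
      have e1 : n + C - n = C := by omega
      have e2 : n + B - n = B := by omega
      have e3 : s + n - (n + C + (n + B)) = A := by omega
      have hs : s = n + C + B + A := by omega
      rw [e1, e2, e3, coeff_const_smul]
      simp only [k_pow, monomial_mul_monomial, ← Finsupp.single_add]
      rw [← hs, coeff_waveMonomial]
      by_cases hc : e .z = 0 ∧ e .zb = 0 ∧ e .t = s ∧ e (.x .b) = A ∧ e (.x .p) = B ∧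
        e (.x .m) = C ∧ e (.x .v) = n
      · rw [if_pos hc]
        obtain ⟨h1, h2, h3, h4, h5, h6, h7⟩ := hc
        rw [if_pos ⟨⟨h1, h2, h3, by omega⟩, by omega, by omega, h7.symm⟩, h4, h5, h6, h7]
        change _ • word q n C B A = _
        congr 1
        have g1 : ((n + C : ℕ) : ℤ) - n + 1 = (C : ℤ) + 1 := by push_cast; ring
        have g2 : ((n + B : ℕ) : ℤ) - n + 1 = (B : ℤ) + 1 := by push_cast; ring
        have g3 : (s : ℤ) - (n + C : ℕ) - (n + B : ℕ) + n + 1 = (A : ℤ) + 1 := by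
          rw [hs]; push_cast; ring
        -- Here `s - a - b = A - n`; writing it as `(A + n) - 2n` exhibits the sign as `(-1)^(A +
        -- n)`.
        have g4 : (s : ℤ) - (n + C : ℕ) - (n + B : ℕ) = ((A + n : ℕ) : ℤ) - 2 * n := by
          rw [hs]; push_cast; ring
        have g5 : ((-1 : ℂ)) ^ (((A + n : ℕ) : ℤ) - 2 * n) = (-1) ^ (A + n) := by
          rw [zpow_sub₀ (by norm_num), zpow_natCast, zpow_mul]; norm_num
        rw [g1, g2, g3, g4, g5]
        simp only [invGamma_natCast_add_one]
        rw [amp, div_eq_mul_inv, mul_inv, mul_inv, mul_inv]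
        have g6 : (n : ℤ) * (2 * (n + C : ℕ) + 2 * (n + B : ℕ) - 2 * n - s)
            + (n + C : ℕ) * (((n + C : ℕ) : ℤ) - s - 1)
            + (n + B : ℕ) * (((A + n : ℕ) : ℤ) - 2 * n + 1)
            = (n : ℤ) * C - n * A - n * B - C * A - C * B + A * B - C + B := by
          rw [hs]; push_cast; ring
        rw [g6]
        ring
      · rw [if_neg hc, if_neg, smul_zero]
        rintro ⟨⟨h1, h2, h3, h4⟩, h5, h6, h7⟩
        apply hc
        refine ⟨h1, h2, h3, ?_, ?_, ?_, ?_⟩ <;> omega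
    · have hz : invGamma q ((a : ℤ) - n + 1) * invGamma q ((b' : ℤ) - n + 1)
          * invGamma q ((s : ℤ) - a - b' + n + 1) = 0 := by
        by_cases h1 : n ≤ a
        · by_cases h2 : n ≤ b'
          · rw [invGamma_of_nonpos (p := (s : ℤ) - a - b' + n + 1) (by omega), mul_zero]
          · rw [invGamma_of_nonpos (p := (b' : ℤ) - n + 1) (by omega), mul_zero, zero_mul]
        · rw [invGamma_of_nonpos (p := (a : ℤ) - n + 1) (by omega), zero_mul, zero_mul]
      rw [if_neg]
      · rw [mul_assoc, mul_assoc, mul_assoc, ← mul_assoc (invGamma q _), ← mul_assoc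
          (invGamma q _ * _), hz]
        simp
      · rintro ⟨⟨h1, h2, h3, h4⟩, h5, h6, h7⟩
        apply hn
        omega
  rw [hTilde, coeff_const_smul]
  simp only [map_sum, key]
  by_cases hc : IsWaveExponent s e
  · have hs := hc.2.2.2
    rw [if_pos hc, Finset.sum_eq_single (e (.x .m) + e (.x .v)),
      Finset.sum_eq_single (e (.x .p) + e (.x .v)), Finset.sum_eq_single (e (.x .v)),
      if_pos ⟨hc, rfl, rfl, rfl⟩]
    · intro b _ hb
      exact if_neg fun h => hb h.2.2.2
    · intro h; simp at h; omega
    · intro b _ hb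
      exact Finset.sum_eq_zero fun _ _ => if_neg fun h => hb h.2.2.1
    · intro h; simp at h; omega
    · intro b _ hb
      exact Finset.sum_eq_zero fun _ _ => Finset.sum_eq_zero fun _ _ => if_neg fun h => hb h.2.1
    · intro h; simp at h; omega
  · simp [hc]

end PlaneWave

/-! ### q-difference equations for the plane wave -/

section DifferenceEquations

open MvPowerSeries

variable {q : ℂ}

theorem coeff_diagOp (c : (Var →₀ ℕ) → ℂ) (f : Field q) (e : Var →₀ ℕ) :
    coeff e (diagOp q c f) = c e • coeff e f := rfl

theorem coeff_D (κ : Var) (f : Field q) (e : Var →₀ ℕ) :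
    coeff e (D q κ f) = qInt q ((e κ : ℤ) + 1) • coeff (e + Finsupp.single κ 1) f := rfl

theorem M_apply (κ : Var) (f : Field q) : M q κ f = X κ * f := rfl

theorem coeff_add_single_X_mul (κ : Var) (f : Field q) (e : Var →₀ ℕ) :
    coeff (e + Finsupp.single κ 1) (X κ * f) = coeff e f := by
  rw [X_def, add_comm, coeff_add_monomial_mul, one_mul]

theorem coeff_X_mul_eq_zero {κ : Var} (f : Field q) {e : Var →₀ ℕ} (h : e κ = 0) :
    coeff e (X κ * f) = 0 := by
  classical
  rw [X_def, coeff_monomial_mul, if_neg]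
  intro h'
  have := h' κ
  simp [h] at this

theorem exists_eq_add_single {κ : Var} {e : Var →₀ ℕ} (h : e κ ≠ 0) :
    ∃ e', e = e' + Finsupp.single κ 1 :=
  ⟨e - Finsupp.single κ 1, (tsub_add_cancel_of_le
    (Finsupp.single_le_iff.2 (Nat.one_le_iff_ne_zero.2 h))).symm⟩

/-- The exponents that occur in a first derivative of `h̃_s`. -/
def IsLowered (s : ℕ) (e : Var →₀ ℕ) : Prop :=
  e .z = 0 ∧ e .zb = 0 ∧ e .t = s ∧ e (.x .b) + e (.x .p) + e (.x .m) + e (.x .v) + 1 = s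

/-- The condition is the same in all four directions, so the four derivatives of `h̃_s` have a
common set of possible exponents and can be compared term by term. -/
theorem isWaveExponent_add_single (s : ℕ) (κ : Dir) (e : Var →₀ ℕ) :
    IsWaveExponent s (e + Finsupp.single (.x κ) 1) ↔ IsLowered s e := by
  rcases κ <;> simp [IsWaveExponent, IsLowered] <;> intros <;> omega

/-- The coefficient that the derivatives of the plane wave have in common. -/
def loweredAmp (q : ℂ) (s : ℕ) (e : Var →₀ ℕ) : ℂ :=
  (invBeta q s)⁻¹ * amp q (e (.x .b)) (e (.x .p)) (e (.x .m)) (e (.x .v))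

/-- The weight `c` is left arbitrary in order to absorb every product of operators `T` that stands
to the right of the derivative. -/
theorem coeff_D_v_diagOp (hq₀ : q ≠ 0) (hq : NonRoot q) (s : ℕ) (c : (Var →₀ ℕ) → ℂ)
    (e : Var →₀ ℕ) :
    coeff e (D q (.x .v) (diagOp q c (hTilde q s))) = open Classical in if IsLowered s e then
      (loweredAmp q s e * (-(q ^ e (.x .m) * (q ^ e (.x .b))⁻¹ * (q ^ e (.x .p))⁻¹)
          * c (e + Finsupp.single (.x .v) 1)))
        • word q (e (.x .v) + 1) (e (.x .m)) (e (.x .p)) (e (.x .b)) else 0 := by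
  rw [coeff_D, coeff_diagOp, coeff_hTilde, isWaveExponent_add_single]
  split_ifs with h
  · have := amp_succ_v hq₀ hq (e (.x .b)) (e (.x .p)) (e (.x .m)) (e (.x .v))
    simp [smul_smul, loweredAmp]
    congr 1
    linear_combination ((invBeta q s)⁻¹ * c (e + Finsupp.single (.x .v) 1)) * this
  · simp

theorem coeff_D_m_diagOp (hq₀ : q ≠ 0) (hq : NonRoot q) (s : ℕ) (c : (Var →₀ ℕ) → ℂ)
    (e : Var →₀ ℕ) :
    coeff e (D q (.x .m) (diagOp q c (hTilde q s))) = open Classical in if IsLowered s e then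
      (loweredAmp q s e * ((q ^ e (.x .v) * (q ^ e (.x .b))⁻¹ * (q ^ e (.x .p))⁻¹ * q⁻¹)
          * c (e + Finsupp.single (.x .m) 1)))
        • word q (e (.x .v)) (e (.x .m) + 1) (e (.x .p)) (e (.x .b)) else 0 := by
  rw [coeff_D, coeff_diagOp, coeff_hTilde, isWaveExponent_add_single]
  split_ifs with h
  · have := amp_succ_m hq₀ hq (e (.x .b)) (e (.x .p)) (e (.x .m)) (e (.x .v))
    simp [smul_smul, loweredAmp]
    congr 1
    linear_combination ((invBeta q s)⁻¹ * c (e + Finsupp.single (.x .m) 1)) * this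
  · simp

theorem coeff_D_p_diagOp (hq₀ : q ≠ 0) (hq : NonRoot q) (s : ℕ) (c : (Var →₀ ℕ) → ℂ)
    (e : Var →₀ ℕ) :
    coeff e (D q (.x .p) (diagOp q c (hTilde q s))) = open Classical in if IsLowered s e then
      (loweredAmp q s e * (((q ^ e (.x .v))⁻¹ * (q ^ e (.x .m))⁻¹ * q ^ e (.x .b) * q)
          * c (e + Finsupp.single (.x .p) 1)))
        • word q (e (.x .v)) (e (.x .m)) (e (.x .p) + 1) (e (.x .b)) else 0 := by
  rw [coeff_D, coeff_diagOp, coeff_hTilde, isWaveExponent_add_single]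
  split_ifs with h
  · have := amp_succ_p hq₀ hq (e (.x .b)) (e (.x .p)) (e (.x .m)) (e (.x .v))
    simp [smul_smul, loweredAmp]
    congr 1
    linear_combination ((invBeta q s)⁻¹ * c (e + Finsupp.single (.x .p) 1)) * this
  · simp

theorem coeff_D_b_diagOp (hq₀ : q ≠ 0) (hq : NonRoot q) (s : ℕ) (c : (Var →₀ ℕ) → ℂ)
    (e : Var →₀ ℕ) :
    coeff e (D q (.x .b) (diagOp q c (hTilde q s))) = open Classical in if IsLowered s e then
      (loweredAmp q s e * (-((q ^ e (.x .v))⁻¹ * (q ^ e (.x .m))⁻¹ * q ^ e (.x .p))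
          * c (e + Finsupp.single (.x .b) 1)))
        • word q (e (.x .v)) (e (.x .m)) (e (.x .p)) (e (.x .b) + 1) else 0 := by
  rw [coeff_D, coeff_diagOp, coeff_hTilde, isWaveExponent_add_single]
  split_ifs with h
  · have := amp_succ_b hq₀ hq (e (.x .b)) (e (.x .p)) (e (.x .m)) (e (.x .v))
    simp [smul_smul, loweredAmp]
    congr 1
    linear_combination ((invBeta q s)⁻¹ * c (e + Finsupp.single (.x .b) 1)) * this
  · simp

/-- The second-order part of the two operators, which carries a factor `λ`. -/
theorem coeff_M_D_D_diagOp (hq₀ : q ≠ 0) (hq : NonRoot q) (s : ℕ) (c c' : (Var →₀ ℕ) → ℂ)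
    (hc : ∀ e, c (e + Finsupp.single (.x .p) 1 + Finsupp.single (.x .m) 1)
      = c' (e + Finsupp.single (.x .v) 1)) (e : Var →₀ ℕ) :
    coeff e ((lam q * q⁻¹) • M q (.x .v) (D q (.x .m) (D q (.x .p) (diagOp q c (hTilde q s)))))
      = open Classical in if IsLowered s e then
      (loweredAmp q s e * (-(q ^ e (.x .v) - (q ^ e (.x .v))⁻¹) * (q ^ e (.x .b) * q ^ e (.x .p)
          * (q ^ e (.x .m))⁻¹ * q⁻¹) * c' e))
        • word q (e (.x .v)) (e (.x .m)) (e (.x .p)) (e (.x .b) + 1) else 0 := by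
  rw [coeff_const_smul, M_apply]
  -- At exponent zero of `v` nothing is in the image of `M̂_v`, and the factor `q^0 - q^(-0)` on the
  -- right vanishes too.
  by_cases h0 : e (.x .v) = 0
  · rw [coeff_X_mul_eq_zero _ h0]
    simp [h0]
  · obtain ⟨e, rfl⟩ := exists_eq_add_single h0
    rw [coeff_add_single_X_mul, coeff_D, coeff_D, coeff_diagOp, coeff_hTilde,
      isWaveExponent_add_single,
      show e + Finsupp.single (Var.x Dir.m) 1 + Finsupp.single (Var.x Dir.p) 1
        = e + Finsupp.single (Var.x Dir.p) 1 + Finsupp.single (Var.x Dir.m) 1 by abel, hc]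
    have hlow : IsLowered s (e + Finsupp.single (.x .m) 1)
        ↔ IsLowered s (e + Finsupp.single (.x .v) 1) := by
      simp [IsLowered]; intros; omega
    by_cases h : IsLowered s (e + Finsupp.single (.x .v) 1)
    · rw [if_pos h, if_pos (hlow.2 h)]
      -- The recursions in `x_+` and `x_-` absorb the q-numbers of the two derivatives. The one in
      -- `v` introduces `[e_v + 1]_q`, which `λ` turns into a difference of two powers. On the side
      -- of the words, `word_reduce` trades the surplus `k_+ k_-` for `k_v̄ k_v`.
      have h1 := amp_succ_p hq₀ hq (e (.x .b)) (e (.x .p)) (e (.x .m) + 1) (e (.x .v))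
      have h2 := amp_succ_m hq₀ hq (e (.x .b)) (e (.x .p)) (e (.x .m)) (e (.x .v))
      have h3 := amp_succ_v hq₀ hq (e (.x .b)) (e (.x .p)) (e (.x .m)) (e (.x .v))
      have h4 := lam_mul_qInt hq₀ hq ((e (.x .v) : ℤ) + 1)
      have k1 : qInt q ((e (.x .m) : ℤ) + 1) * (qInt q ((e (.x .p) : ℤ) + 1)
          * amp q (e (.x .b)) (e (.x .p) + 1) (e (.x .m) + 1) (e (.x .v)))
          * (q * (q ^ e (.x .m) * q ^ e (.x .p)))
          = amp q (e (.x .b)) (e (.x .p)) (e (.x .m)) (e (.x .v)) := by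
        rw [h1, mul_left_comm (qInt q ((e (.x .m) : ℤ) + 1)), h2, pow_succ]
        field_simp
      have k2 : amp q (e (.x .b)) (e (.x .p)) (e (.x .m)) (e (.x .v))
          = -((q ^ e (.x .m))⁻¹ * q ^ e (.x .b) * q ^ e (.x .p)) * (qInt q ((e (.x .v) : ℤ) + 1)
            * amp q (e (.x .b)) (e (.x .p)) (e (.x .m)) (e (.x .v) + 1)) := by
        rw [h3]
        field_simp
      have k3 : lam q * qInt q ((e (.x .v) : ℤ) + 1)
          = q ^ (e (.x .v) + 1) - (q ^ (e (.x .v) + 1))⁻¹ := by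
        rw [h4, zpow_neg]; norm_cast
      classical
      simp only [Finsupp.add_apply, Finsupp.single_apply, reduceCtorEq, Var.x.injEq, if_true,
        if_false, add_zero, smul_smul, loweredAmp, word_reduce hq₀]
      congr 1
      rw [k2] at k1
      rw [← k3]
      linear_combination (lam q * q⁻¹ * c' (e + Finsupp.single (.x .v) 1) * (invBeta q s)⁻¹)
        * k1
    · rw [if_neg h, if_neg (hlow.not.2 h)]
      simp

end DifferenceEquations

/-! ### Proportionality relations between the first derivatives of the plane wave. -/

section FirstOrderRelations

open MvPowerSeries

variable {q : ℂ}

theorem diagOp_diagOp (c c' : (Var →₀ ℕ) → ℂ) (f : Field q) :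
    diagOp q c (diagOp q c' f) = diagOp q (fun e => c e * c' e) f := by
  ext e
  simp only [coeff_diagOp, smul_smul]

theorem T_eq (κ : Var) : T q κ = diagOp q fun e => q ^ e κ := rfl

theorem Tinv_eq (κ : Var) : Tinv q κ = diagOp q fun e => (q ^ e κ)⁻¹ := rfl

theorem k_mul_congr {κ κ' : Dir} {f g : Field q} {c : ℂ}
    (h : ∀ e, mom q κ * coeff e f = c • (mom q κ' * coeff e g)) :
    k q κ * f = c • (k q κ' * g) := by
  rw [k, k, mul_assoc, mul_assoc, ← mul_smul_comm]
  congr 1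
  ext e
  rw [coeff_C_mul, h, coeff_const_smul, coeff_C_mul]

/-- The operator `D̂_v T_v`. -/
def plusV (q : ℂ) : Module.End ℂ (Field q) := D q (.x .v) * T q (.x .v)

/-- The operator `D̂_+ T_- T_v̄⁻¹ T_v²`. -/
def plusP (q : ℂ) : Module.End ℂ (Field q) :=
  D q (.x .p) * T q (.x .m) * Tinv q (.x .b) * T q (.x .v) * T q (.x .v)

/-- The operator `D̂_- T_- T_v`. -/
def plusM (q : ℂ) : Module.End ℂ (Field q) := D q (.x .m) * T q (.x .m) * T q (.x .v)

/-- The operator `(D̂_v̄ T_- + λ q⁻¹ M̂_v D̂_- D̂_+ T_v̄⁻¹ T_-) T_- T_v`. -/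
def plusB (q : ℂ) : Module.End ℂ (Field q) :=
  (D q (.x .b) * T q (.x .m) + (lam q * q⁻¹) • (M q (.x .v) * D q (.x .m) * D q (.x .p)
    * Tinv q (.x .b) * T q (.x .m))) * T q (.x .m) * T q (.x .v)

/-- The operator `(D̂_v̄ T_v̄ T_- + q⁻¹ λ M̂_v D̂_- D̂_+ T_-) T_+`. -/
def minusB (q : ℂ) : Module.End ℂ (Field q) :=
  (D q (.x .b) * T q (.x .b) * T q (.x .m) + (q⁻¹ * lam q) • (M q (.x .v) * D q (.x .m)
    * D q (.x .p) * T q (.x .m))) * T q (.x .p)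

/-- The operator `D̂_+ T_v T_+`. -/
def minusP (q : ℂ) : Module.End ℂ (Field q) := D q (.x .p) * T q (.x .v) * T q (.x .p)

/-- The operator `D̂_- T_v̄ T_+`. -/
def minusM (q : ℂ) : Module.End ℂ (Field q) := D q (.x .m) * T q (.x .b) * T q (.x .p)

/-- The operator `D̂_v T_-⁻¹ T_v̄ T_+`. -/
def minusV (q : ℂ) : Module.End ℂ (Field q) :=
  D q (.x .v) * Tinv q (.x .m) * T q (.x .b) * T q (.x .p)

theorem coeff_plusV (hq₀ : q ≠ 0) (hq : NonRoot q) (s : ℕ) (e : Var →₀ ℕ) :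
    coeff e (plusV q (hTilde q s)) = open Classical in if IsLowered s e then
      (loweredAmp q s e * -(q ^ e (.x .m) * (q ^ e (.x .b))⁻¹ * (q ^ e (.x .p))⁻¹
          * q ^ (e (.x .v) + 1)))
        • word q (e (.x .v) + 1) (e (.x .m)) (e (.x .p)) (e (.x .b)) else 0 := by
  simp only [plusV, Module.End.mul_apply, T_eq]
  rw [coeff_D_v_diagOp hq₀ hq]
  simp

theorem coeff_plusM (hq₀ : q ≠ 0) (hq : NonRoot q) (s : ℕ) (e : Var →₀ ℕ) :
    coeff e (plusM q (hTilde q s)) = open Classical in if IsLowered s e then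
      (loweredAmp q s e * (q ^ e (.x .v) * q ^ e (.x .v) * q ^ e (.x .m)
          * (q ^ e (.x .b))⁻¹ * (q ^ e (.x .p))⁻¹))
        • word q (e (.x .v)) (e (.x .m) + 1) (e (.x .p)) (e (.x .b)) else 0 := by
  simp only [plusM, Module.End.mul_apply, T_eq, diagOp_diagOp]
  rw [coeff_D_m_diagOp hq₀ hq]
  congr 3
  simp [pow_succ]
  field_simp

theorem coeff_plusP (hq₀ : q ≠ 0) (hq : NonRoot q) (s : ℕ) (e : Var →₀ ℕ) :
    coeff e (plusP q (hTilde q s)) = open Classical in if IsLowered s e then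
      (loweredAmp q s e * (q * q ^ e (.x .v)))
        • word q (e (.x .v)) (e (.x .m)) (e (.x .p) + 1) (e (.x .b)) else 0 := by
  simp only [plusP, Module.End.mul_apply, T_eq, Tinv_eq, diagOp_diagOp]
  rw [coeff_D_p_diagOp hq₀ hq]
  congr 3
  simp
  field_simp

/-- The derivative along `v̄` alone carries the wrong power of `q^(e_v)`. The second-order term
contributes a multiple of `q^(e_v) - q^(-e_v)` whose second half cancels it, leaving one monomial in
q. The same happens in `coeff_minusB`. -/
theorem coeff_plusB (hq₀ : q ≠ 0) (hq : NonRoot q) (s : ℕ) (e : Var →₀ ℕ) :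
    coeff e (plusB q (hTilde q s)) = open Classical in if IsLowered s e then
      (loweredAmp q s e * -(q ^ e (.x .v) * q ^ e (.x .v) * q ^ e (.x .m) * q ^ e (.x .p)))
        • word q (e (.x .v)) (e (.x .m)) (e (.x .p)) (e (.x .b) + 1) else 0 := by
  simp only [plusB, Module.End.mul_apply, LinearMap.add_apply, LinearMap.smul_apply, T_eq, Tinv_eq,
    diagOp_diagOp]
  -- The second weight is the first one re-expressed after trading one `x_+` and one `x_-` for one
  -- `v`: each `T_-` gains a factor `q`, and `T_v` gains `q⁻¹`.
  rw [map_add, coeff_D_b_diagOp hq₀ hq, coeff_M_D_D_diagOp hq₀ hq s _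
    (fun e => (q ^ e (.x .b))⁻¹ * (q ^ e (.x .m) * q * (q ^ e (.x .m) * q * (q ^ e (.x .v) * q⁻¹))))]
  · split_ifs
    · rw [← add_smul]
      congr 1
      simp
      field_simp
      ring
    · simp
  · intro e
    simp [pow_succ]
    field_simp
    simp

theorem coeff_minusB (hq₀ : q ≠ 0) (hq : NonRoot q) (s : ℕ) (e : Var →₀ ℕ) :
    coeff e (minusB q (hTilde q s)) = open Classical in if IsLowered s e then
      (loweredAmp q s e * -(q ^ e (.x .v) * q ^ e (.x .b) * q ^ e (.x .p) * q ^ e (.x .p) * q))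
        • word q (e (.x .v)) (e (.x .m)) (e (.x .p)) (e (.x .b) + 1) else 0 := by
  simp only [minusB, Module.End.mul_apply, LinearMap.add_apply, LinearMap.smul_apply, T_eq,
    diagOp_diagOp, mul_comm q⁻¹]
  rw [map_add, coeff_D_b_diagOp hq₀ hq, coeff_M_D_D_diagOp hq₀ hq s _
    (fun e => q ^ e (.x .m) * q * (q ^ e (.x .p) * q))]
  · split_ifs
    · rw [← add_smul]
      congr 1
      simp [pow_succ]
      field_simp
      ring
    · simp
  · intro e
    simp [pow_succ]

theorem coeff_minusM (hq₀ : q ≠ 0) (hq : NonRoot q) (s : ℕ) (e : Var →₀ ℕ) :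
    coeff e (minusM q (hTilde q s)) = open Classical in if IsLowered s e then
      (loweredAmp q s e * (q ^ e (.x .v) * q⁻¹))
        • word q (e (.x .v)) (e (.x .m) + 1) (e (.x .p)) (e (.x .b)) else 0 := by
  simp only [minusM, Module.End.mul_apply, T_eq, diagOp_diagOp]
  rw [coeff_D_m_diagOp hq₀ hq]
  congr 3
  simp
  field_simp

theorem coeff_minusP (hq₀ : q ≠ 0) (hq : NonRoot q) (s : ℕ) (e : Var →₀ ℕ) :
    coeff e (minusP q (hTilde q s)) = open Classical in if IsLowered s e then
      (loweredAmp q s e * ((q ^ e (.x .m))⁻¹ * q ^ e (.x .b) * q ^ e (.x .p) * q * q))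
        • word q (e (.x .v)) (e (.x .m)) (e (.x .p) + 1) (e (.x .b)) else 0 := by
  simp only [minusP, Module.End.mul_apply, T_eq, diagOp_diagOp]
  rw [coeff_D_p_diagOp hq₀ hq]
  congr 3
  simp [pow_succ]
  field_simp

theorem coeff_minusV (hq₀ : q ≠ 0) (hq : NonRoot q) (s : ℕ) (e : Var →₀ ℕ) :
    coeff e (minusV q (hTilde q s)) = open Classical in if IsLowered s e then
      (loweredAmp q s e * -1)
        • word q (e (.x .v) + 1) (e (.x .m)) (e (.x .p)) (e (.x .b)) else 0 := by
  simp only [minusV, Module.End.mul_apply, T_eq, Tinv_eq, diagOp_diagOp]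
  rw [coeff_D_v_diagOp hq₀ hq]
  congr 3
  simp
  field_simp

/-- After reduction on the cone both sides show the same word at every exponent, and the powers of q
differ by a factor independent of the exponent. The factor is the same in all four relations of this
sign, so one polynomial in `z` can satisfy all the components of the equation. -/
theorem v_mul_plusV (hq₀ : q ≠ 0) (hq : NonRoot q) (s : ℕ) :
    k q .v * plusV q (hTilde q s) = (-q ^ 2) • (k q .m * plusM q (hTilde q s)) := by
  refine k_mul_congr fun e => ?_
  rw [coeff_plusV hq₀ hq, coeff_plusM hq₀ hq]
  split_ifs
  · simp only [mul_smul_comm, v_mul_word hq₀, m_mul_word hq₀, word_reduce hq₀, smul_smul]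
    congr 1
    simp only [pow_succ]
    field_simp
  · simp

theorem p_mul_plusV (hq₀ : q ≠ 0) (hq : NonRoot q) (s : ℕ) :
    k q .p * plusV q (hTilde q s) = (-q ^ 2) • (k q .b * plusM q (hTilde q s)) := by
  refine k_mul_congr fun e => ?_
  rw [coeff_plusV hq₀ hq, coeff_plusM hq₀ hq]
  split_ifs
  · simp only [mul_smul_comm, p_mul_word, b_mul_word, smul_smul]
    congr 1
    simp only [pow_succ]
    field_simp
  · simp

theorem v_mul_plusP (hq₀ : q ≠ 0) (hq : NonRoot q) (s : ℕ) :
    k q .v * plusP q (hTilde q s) = (-q ^ 2) • (k q .m * plusB q (hTilde q s)) := by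
  refine k_mul_congr fun e => ?_
  rw [coeff_plusP hq₀ hq, coeff_plusB hq₀ hq]
  split_ifs
  · simp only [mul_smul_comm, v_mul_word hq₀, m_mul_word hq₀, smul_smul]
    congr 1
    simp only [pow_succ]
    field_simp
  · simp

theorem p_mul_plusP (hq₀ : q ≠ 0) (hq : NonRoot q) (s : ℕ) :
    k q .p * plusP q (hTilde q s) = (-q ^ 2) • (k q .b * plusB q (hTilde q s)) := by
  refine k_mul_congr fun e => ?_
  rw [coeff_plusP hq₀ hq, coeff_plusB hq₀ hq]
  split_ifs
  · simp only [mul_smul_comm, p_mul_word, b_mul_word, word_reduce hq₀, smul_smul]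
    congr 1
    simp only [pow_succ]
    field_simp
  · simp

/-- In the minus case the ratio of the derivatives involves all four exponents through their sum,
which is `s - 1`. This is how `s` enters the coefficients of `F̃^{h-}`. -/
theorem IsLowered.pow_eq {s : ℕ} {e : Var →₀ ℕ} (h : IsLowered s e) (r : ℕ) :
    q ^ (s + r)
      = q ^ e (.x .b) * q ^ e (.x .p) * q ^ e (.x .m) * q ^ e (.x .v) * q * q ^ r := by
  rw [← pow_add, ← pow_add, ← pow_add, ← pow_succ, ← pow_add, h.2.2.2]

theorem b_mul_minusB (hq₀ : q ≠ 0) (hq : NonRoot q) (s : ℕ) :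
    k q .b * minusB q (hTilde q s) = (-q ^ (s + 2)) • (k q .m * minusM q (hTilde q s)) := by
  refine k_mul_congr fun e => ?_
  rw [coeff_minusB hq₀ hq, coeff_minusM hq₀ hq]
  split_ifs with h
  · rw [h.pow_eq]
    simp only [mul_smul_comm, b_mul_word, m_mul_word hq₀, word_reduce hq₀, smul_smul]
    congr 1
    simp only [pow_succ]
    field_simp
  · simp

theorem p_mul_minusB (hq₀ : q ≠ 0) (hq : NonRoot q) (s : ℕ) :
    k q .p * minusB q (hTilde q s) = (-q ^ (s + 2)) • (k q .v * minusM q (hTilde q s)) := by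
  refine k_mul_congr fun e => ?_
  rw [coeff_minusB hq₀ hq, coeff_minusM hq₀ hq]
  split_ifs with h
  · rw [h.pow_eq]
    simp only [mul_smul_comm, p_mul_word, v_mul_word hq₀, smul_smul]
    congr 1
    simp only [pow_succ]
    field_simp
  · simp

theorem b_mul_minusP (hq₀ : q ≠ 0) (hq : NonRoot q) (s : ℕ) :
    k q .b * minusP q (hTilde q s) = (-q ^ (s + 2)) • (k q .m * minusV q (hTilde q s)) := by
  refine k_mul_congr fun e => ?_
  rw [coeff_minusP hq₀ hq, coeff_minusV hq₀ hq]
  split_ifs with h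
  · rw [h.pow_eq]
    simp only [mul_smul_comm, b_mul_word, m_mul_word hq₀, smul_smul]
    congr 1
    simp only [pow_succ]
    field_simp
  · simp

theorem p_mul_minusP (hq₀ : q ≠ 0) (hq : NonRoot q) (s : ℕ) :
    k q .p * minusP q (hTilde q s) = (-q ^ (s + 2)) • (k q .v * minusV q (hTilde q s)) := by
  refine k_mul_congr fun e => ?_
  rw [coeff_minusP hq₀ hq, coeff_minusV hq₀ hq]
  split_ifs with h
  · rw [h.pow_eq]
    simp only [mul_smul_comm, p_mul_word, v_mul_word hq₀, word_reduce hq₀, smul_smul]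
    congr 1
    simp only [pow_succ]
    field_simp
  · simp

end FirstOrderRelations

/-! ### Solutions of the q-Maxwell equations -/

section MaxwellEquations

open MvPowerSeries

variable {q : ℂ}

/-- The operator `A` commutes with left multiplication by `u`. -/
def CommutesLeft (u : Field q) (A : Module.End ℂ (Field q)) : Prop :=
  ∀ f, A (u * f) = u * A f

namespace CommutesLeft

variable {u : Field q} {A B : Module.End ℂ (Field q)}

theorem mul (hA : CommutesLeft u A) (hB : CommutesLeft u B) : CommutesLeft u (A * B) :=
  fun f => by rw [Module.End.mul_apply, hB, hA, Module.End.mul_apply]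

theorem add (hA : CommutesLeft u A) (hB : CommutesLeft u B) : CommutesLeft u (A + B) :=
  fun f => by rw [LinearMap.add_apply, hB, hA, LinearMap.add_apply, mul_add]

theorem smul (c : ℂ) (hA : CommutesLeft u A) : CommutesLeft u (c • A) :=
  fun f => by rw [LinearMap.smul_apply, hA, LinearMap.smul_apply, mul_smul_comm]

end CommutesLeft

theorem coeff_monomial_mul_eq_zero {d e : Var →₀ ℕ} (w : Mom q) (f : Field q) (h : ¬ d ≤ e) :
    coeff e (monomial d w * f) = 0 := by
  classical
  rw [coeff_monomial_mul, if_neg h]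

theorem commutesLeft_diagOp (d : Var →₀ ℕ) (w : Mom q) {c : (Var →₀ ℕ) → ℂ}
    (hc : ∀ e, c (d + e) = c e) : CommutesLeft (monomial d w) (diagOp q c) := by
  intro f
  ext e
  rw [coeff_diagOp]
  by_cases h : d ≤ e
  · obtain ⟨e, rfl⟩ := exists_add_of_le h
    rw [coeff_add_monomial_mul, coeff_add_monomial_mul, coeff_diagOp, hc, mul_smul_comm]
  · rw [coeff_monomial_mul_eq_zero _ _ h, coeff_monomial_mul_eq_zero _ _ h, smul_zero]

theorem commutesLeft_T {d : Var →₀ ℕ} (w : Mom q) {κ : Var} (h : d κ = 0) :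
    CommutesLeft (monomial d w) (T q κ) :=
  commutesLeft_diagOp d w fun e => by simp [h]

theorem commutesLeft_Tinv {d : Var →₀ ℕ} (w : Mom q) {κ : Var} (h : d κ = 0) :
    CommutesLeft (monomial d w) (Tinv q κ) :=
  commutesLeft_diagOp d w fun e => by simp [h]

theorem commutesLeft_D {d : Var →₀ ℕ} (w : Mom q) {κ : Var} (h : d κ = 0) :
    CommutesLeft (monomial d w) (D q κ) := by
  intro f
  ext e
  rw [coeff_D]
  by_cases hd : d ≤ e
  · obtain ⟨e, rfl⟩ := exists_add_of_le hd
    rw [add_assoc, coeff_add_monomial_mul, coeff_add_monomial_mul, coeff_D, mul_smul_comm]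
    simp [h]
  · rw [coeff_monomial_mul_eq_zero _ _ hd, coeff_monomial_mul_eq_zero, smul_zero]
    intro hd'
    apply hd
    intro κ'
    by_cases hκ : κ' = κ
    · simp [hκ, h]
    · simpa [Finsupp.single_apply, Ne.symm hκ] using hd' κ'

theorem commutesLeft_M (d : Var →₀ ℕ) (w : Mom q) (κ : Var) :
    CommutesLeft (monomial d w) (M q κ) := by
  intro f
  rw [M_apply, M_apply, ← mul_assoc, ← mul_assoc, (commute_X (monomial d w) κ).eq]

/-- The exponents of the variables `t, z, z̄` alone. -/
def IsInternal (d : Var →₀ ℕ) : Prop := ∀ κ, d (.x κ) = 0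

/-- The operator involves only coordinates, and the monomial contains none. This lets momenta and
spin variables be pulled out to the left; the other seven operators behave alike. -/
theorem commutesLeft_plusV {d : Var →₀ ℕ} (hd : IsInternal d) (w : Mom q) :
    CommutesLeft (monomial d w) (plusV q) := by
  unfold plusV
  repeat' first
    | apply CommutesLeft.add | apply CommutesLeft.mul | apply CommutesLeft.smul
    | exact commutesLeft_M d w _ | exact commutesLeft_D w (hd _) | exact commutesLeft_T w (hd _)

theorem commutesLeft_plusP {d : Var →₀ ℕ} (hd : IsInternal d) (w : Mom q) :
    CommutesLeft (monomial d w) (plusP q) := by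
  unfold plusP
  repeat' first
    | apply CommutesLeft.add | apply CommutesLeft.mul | apply CommutesLeft.smul
    | exact commutesLeft_M d w _ | exact commutesLeft_D w (hd _) | exact commutesLeft_T w (hd _)
    | exact commutesLeft_Tinv w (hd _)

theorem commutesLeft_plusM {d : Var →₀ ℕ} (hd : IsInternal d) (w : Mom q) :
    CommutesLeft (monomial d w) (plusM q) := by
  unfold plusM
  repeat' first
    | apply CommutesLeft.add | apply CommutesLeft.mul | apply CommutesLeft.smul
    | exact commutesLeft_M d w _ | exact commutesLeft_D w (hd _) | exact commutesLeft_T w (hd _)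

theorem commutesLeft_plusB {d : Var →₀ ℕ} (hd : IsInternal d) (w : Mom q) :
    CommutesLeft (monomial d w) (plusB q) := by
  unfold plusB
  repeat' first
    | apply CommutesLeft.add | apply CommutesLeft.mul | apply CommutesLeft.smul
    | exact commutesLeft_M d w _ | exact commutesLeft_D w (hd _) | exact commutesLeft_T w (hd _)
    | exact commutesLeft_Tinv w (hd _)

theorem commutesLeft_minusV {d : Var →₀ ℕ} (hd : IsInternal d) (w : Mom q) :
    CommutesLeft (monomial d w) (minusV q) := by
  unfold minusV
  repeat' first
    | apply CommutesLeft.add | apply CommutesLeft.mul | apply CommutesLeft.smul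
    | exact commutesLeft_M d w _ | exact commutesLeft_D w (hd _) | exact commutesLeft_T w (hd _)
    | exact commutesLeft_Tinv w (hd _)

theorem commutesLeft_minusP {d : Var →₀ ℕ} (hd : IsInternal d) (w : Mom q) :
    CommutesLeft (monomial d w) (minusP q) := by
  unfold minusP
  repeat' first
    | apply CommutesLeft.add | apply CommutesLeft.mul | apply CommutesLeft.smul
    | exact commutesLeft_M d w _ | exact commutesLeft_D w (hd _) | exact commutesLeft_T w (hd _)

theorem commutesLeft_minusM {d : Var →₀ ℕ} (hd : IsInternal d) (w : Mom q) :
    CommutesLeft (monomial d w) (minusM q) := by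
  unfold minusM
  repeat' first
    | apply CommutesLeft.add | apply CommutesLeft.mul | apply CommutesLeft.smul
    | exact commutesLeft_M d w _ | exact commutesLeft_D w (hd _) | exact commutesLeft_T w (hd _)

theorem commutesLeft_minusB {d : Var →₀ ℕ} (hd : IsInternal d) (w : Mom q) :
    CommutesLeft (monomial d w) (minusB q) := by
  unfold minusB
  repeat' first
    | apply CommutesLeft.add | apply CommutesLeft.mul | apply CommutesLeft.smul
    | exact commutesLeft_M d w _ | exact commutesLeft_D w (hd _) | exact commutesLeft_T w (hd _)


/-! #### Normal forms of the Maxwell operators -/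

theorem D_mul_diagOp {κ : Var} {c : (Var →₀ ℕ) → ℂ}
    (hc : ∀ e, c (e + Finsupp.single κ 1) = c e) : D q κ * diagOp q c = diagOp q c * D q κ := by
  ext f : 1
  ext e
  rw [Module.End.mul_apply, Module.End.mul_apply, coeff_D, coeff_diagOp, coeff_diagOp, coeff_D, hc,
    smul_comm]

theorem diagOp_mul_comm (c c' : (Var →₀ ℕ) → ℂ) :
    diagOp q c * diagOp q c' = diagOp q c' * diagOp q c := by
  ext f : 1
  ext e
  rw [Module.End.mul_apply, Module.End.mul_apply, coeff_diagOp, coeff_diagOp, coeff_diagOp,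
    coeff_diagOp, smul_comm]

theorem D_mul_T {κ κ' : Var} (h : κ ≠ κ') : D q κ * T q κ' = T q κ' * D q κ :=
  D_mul_diagOp fun e => by simp [h]

theorem M_mul_M (κ κ' : Var) : M q κ * M q κ' = M q κ' * M q κ := by
  ext f : 1
  simp only [Module.End.mul_apply, M_apply, ← mul_assoc]
  rw [(commute_X (X κ : Field q) κ').eq]

/-- Operators in different variables commute, so the coordinate part separates from the part acting
on `z`, which can then be evaluated first. -/
theorem maxwellPlus_eq : maxwellPlus q 0
    = (1 / 2 * q) • ((plusV q + M q .zb * plusP q) * qIntSub q 2 .z)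
      - (1 / 2 * q ^ 3) • ((plusM q + M q .zb * plusB q) * D q .z) := by
  have hm : D q .z * T q (.x .m) = T q (.x .m) * D q .z := D_mul_T (by simp)
  have hv : D q .z * T q (.x .v) = T q (.x .v) * D q .z := D_mul_T (by simp)
  have hM : ∀ x, M q (.x .v) * (M q .zb * x) = M q .zb * (M q (.x .v) * x) := fun x => by
    rw [← mul_assoc, M_mul_M, mul_assoc]
  have h3 : q ^ ((0 : ℤ) + 3) = q ^ 3 := by norm_cast
  rw [maxwellPlus, h3, zero_add, mul_assoc _ (D q .z), mul_assoc _ (D q .z * _), hm,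
    mul_assoc (T q _), hv]
  simp only [plusV, plusP, plusM, plusB, add_mul, mul_add, mul_assoc, smul_mul_assoc,
    mul_smul_comm, hM]
  abel_nf

theorem sub_mul_end (A B C : Module.End ℂ (Field q)) : (A - B) * C = A * C - B * C :=
  sub_mul A B C

theorem maxwellMinus_eq : maxwellMinus q 0
    = (1 / 2 : ℂ) • (((minusB q + M q .z * minusP q) * (qIntSub q 2 .zb * T q .zb)
      - (q⁻¹ * q⁻¹) • ((minusM q + M q .z * minusV q) * (D q .zb * T q .zb))) * Tinv q .z) := by
  have h1 : D q .zb * T q (.x .b) = T q (.x .b) * D q .zb := D_mul_T (by simp)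
  have h2 : D q .zb * T q (.x .p) = T q (.x .p) * D q .zb := D_mul_T (by simp)
  have h3 : qIntSub q 2 .zb * T q (.x .p) = T q (.x .p) * qIntSub q 2 .zb := diagOp_mul_comm _ _
  have h4 : ∀ x, D q .zb * (T q (.x .b) * (T q (.x .p) * x))
      = T q (.x .b) * (T q (.x .p) * (D q .zb * x)) := fun x => by
    rw [← mul_assoc, h1, mul_assoc, ← mul_assoc (D q .zb), h2, mul_assoc]
  have h5 : ∀ x, qIntSub q 2 .zb * (T q (.x .p) * x) = T q (.x .p) * (qIntSub q 2 .zb * x) :=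
    fun x => by rw [← mul_assoc, h3, mul_assoc]
  have h6 : q ^ (-(0 : ℤ) - 2) = q⁻¹ * q⁻¹ := by
    rw [neg_zero, zero_sub, zpow_neg]; norm_cast; rw [pow_two, mul_inv]
  rw [maxwellMinus, h6, zero_add]
  simp only [minusV, minusP, minusM, minusB, add_mul, sub_mul_end, mul_assoc,
    smul_mul_assoc, h4, h5]
  congr 2
  abel

/-! #### Fields of degree at most two in a spin variable -/

/-- The field `f` does not contain the variable `κ`. -/
def FreeOf (κ : Var) (f : Field q) : Prop := ∀ e : Var →₀ ℕ, e κ ≠ 0 → coeff e f = 0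

theorem D_of_freeOf {κ : Var} {f : Field q} (hf : FreeOf κ f) : D q κ f = 0 := by
  ext e
  rw [coeff_D, hf _ (by simp), smul_zero, map_zero]

theorem diagOp_of_freeOf {κ : Var} {f : Field q} (hf : FreeOf κ f) {c : (Var →₀ ℕ) → ℂ} {a : ℂ}
    (hc : ∀ e, e κ = 0 → c e = a) : diagOp q c f = a • f := by
  ext e
  rw [coeff_diagOp, coeff_const_smul]
  by_cases h : e κ = 0
  · rw [hc e h]
  · rw [hf e h, smul_zero, smul_zero]

theorem D_X_mul_of_freeOf (hq₀ : q ≠ 0) (hq : NonRoot q) {κ : Var} {f : Field q}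
    (hf : FreeOf κ f) : D q κ (X κ * f) = f := by
  ext e
  rw [coeff_D, coeff_add_single_X_mul]
  by_cases h : e κ = 0
  · simp [h, qInt_one hq₀ hq]
  · rw [hf e h, smul_zero]

theorem diagOp_X_mul {κ : Var} {f : Field q} (c : (Var →₀ ℕ) → ℂ) :
    diagOp q c (X κ * f) = X κ * diagOp q (fun e => c (e + Finsupp.single κ 1)) f := by
  ext e
  rw [coeff_diagOp]
  by_cases h : e κ = 0
  · rw [coeff_X_mul_eq_zero _ h, coeff_X_mul_eq_zero _ h, smul_zero]
  · obtain ⟨e, rfl⟩ := exists_eq_add_single h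
    rw [coeff_add_single_X_mul, coeff_add_single_X_mul, coeff_diagOp]

theorem D_X_mul_X_mul_of_freeOf {κ : Var} {f : Field q}
    (hf : FreeOf κ f) : D q κ (X κ * (X κ * f)) = qInt q 2 • (X κ * f) := by
  ext e
  rw [coeff_D, coeff_add_single_X_mul, coeff_const_smul]
  by_cases h : e κ = 0
  · rw [coeff_X_mul_eq_zero _ h, smul_zero, smul_zero]
  · obtain ⟨e, rfl⟩ := exists_eq_add_single h
    rw [coeff_add_single_X_mul]
    by_cases h : e κ = 0
    · simp [h, one_add_one_eq_two]
    · rw [hf e h, smul_zero, smul_zero]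

/-! #### Quadratic solutions -/

/-- The series `u` is a momentum of degree `d`. -/
def IsMomentum (d : ℕ) (u : Field q) : Prop := ∃ w, u = monomial (Finsupp.single Var.t d) w

theorem isMomentum_k (κ : Dir) : IsMomentum 1 (k q κ) := ⟨mom q κ, by simpa using k_pow κ 1⟩

theorem isMomentum_k_pow (κ : Dir) (n : ℕ) : IsMomentum n (k q κ ^ n) := ⟨_, k_pow κ n⟩

namespace IsMomentum

variable {d d' : ℕ} {u u' : Field q}

theorem mul (h : IsMomentum d u) (h' : IsMomentum d' u') : IsMomentum (d + d') (u * u') := by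
  obtain ⟨w, rfl⟩ := h
  obtain ⟨w', rfl⟩ := h'
  exact ⟨w * w', by rw [monomial_mul_monomial, Finsupp.single_add]⟩

theorem add (h : IsMomentum d u) (h' : IsMomentum d u') : IsMomentum d (u + u') := by
  obtain ⟨w, rfl⟩ := h
  obtain ⟨w', rfl⟩ := h'
  exact ⟨w + w', by rw [map_add]⟩

theorem smul (c : ℂ) (h : IsMomentum d u) : IsMomentum d (c • u) := by
  classical
  obtain ⟨w, rfl⟩ := h
  refine ⟨c • w, ?_⟩
  ext e
  rw [coeff_const_smul, coeff_monomial, coeff_monomial, smul_ite, smul_zero]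

theorem freeOf_mul_hTilde (h : IsMomentum d u) (s : ℕ) {κ : Var} (hκ : κ = .z ∨ κ = .zb) :
    FreeOf κ (u * hTilde q s) := by
  obtain ⟨w, rfl⟩ := h
  intro e he
  by_cases hd : Finsupp.single Var.t d ≤ e
  · obtain ⟨e, rfl⟩ := exists_add_of_le hd
    rw [coeff_add_monomial_mul, coeff_hTilde, if_neg, mul_zero]
    rcases hκ with rfl | rfl
    · simp at he
      exact fun h => he h.1
    · simp at he
      exact fun h => he h.2.1
  · rw [coeff_monomial_mul_eq_zero _ _ hd]

end IsMomentum

theorem isInternal_single {κ : Var} (h : ∀ κ', κ ≠ .x κ') (n : ℕ) :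
    IsInternal (Finsupp.single κ n) := fun κ' => by
  simp [h]

/-- The spin variable is central although the momenta are not; sorting by its powers gives the three
coefficients fed into the Maxwell operators. -/
theorem quadratic_expand {A : Type*} [Ring A] [Algebra ℂ A] {x : A} (hx : ∀ y, y * x = x * y)
    (Q a b c d h : A) (ρ σ : ℂ) :
    Q * (a - ρ • (x * b)) * (c - σ • (x * d)) * h
      = Q * a * c * h + x * (((-ρ) • (Q * b * c) + (-σ) • (Q * a * d)) * h)
        + x * (x * ((ρ * σ) • (Q * b * d) * h)) := by
  have hX : ∀ y y' : A, y * (x * y') = x * (y * y') := fun y y' => by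
    rw [← mul_assoc, hx, mul_assoc]
  have hQ := hX Q
  have ha := hX a
  have hb := hX b
  simp only [mul_sub, sub_mul, add_mul, mul_add, mul_smul_comm, smul_mul_assoc, mul_assoc, hQ, ha,
    hb]
  module

end MaxwellEquations

/-! ### Maxwell operators on products of two factors linear in the spin variable. -/

section QuadraticSolutions

open MvPowerSeries

variable {q : ℂ}

theorem isInternal_t (n : ℕ) : IsInternal (Finsupp.single Var.t n) :=
  isInternal_single (by simp) n

theorem IsMomentum.map_mul {d : ℕ} {u : Field q} (h : IsMomentum d u)
    {A : Module.End ℂ (Field q)}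
    (hA : ∀ {d : Var →₀ ℕ}, IsInternal d → ∀ w : Mom q, CommutesLeft (monomial d w) A)
    (f : Field q) : A (u * f) = u * A f := by
  obtain ⟨w, rfl⟩ := h
  exact hA (isInternal_t d) w f

theorem map_X_mul {κ : Var} (hκ : ∀ κ', κ ≠ .x κ') {A : Module.End ℂ (Field q)}
    (hA : ∀ {d : Var →₀ ℕ}, IsInternal d → ∀ w : Mom q, CommutesLeft (monomial d w) A)
    (f : Field q) : A (X κ * f) = X κ * A f :=
  hA (isInternal_single hκ 1) 1 f

theorem maxwellPlus_apply (f : Field q) : maxwellPlus q 0 f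
    = (1 / 2 * q) • (plusV q (qIntSub q 2 .z f) + X .zb * plusP q (qIntSub q 2 .z f))
      - (1 / 2 * q ^ 3) • (plusM q (D q .z f) + X .zb * plusB q (D q .z f)) := by
  rw [maxwellPlus_eq]; rfl

theorem maxwellMinus_apply (f : Field q) : maxwellMinus q 0 f
    = (1 / 2 : ℂ) • ((minusB q (qIntSub q 2 .zb (T q .zb (Tinv q .z f)))
          + X .z * minusP q (qIntSub q 2 .zb (T q .zb (Tinv q .z f))))
      - (q⁻¹ * q⁻¹) • (minusM q (D q .zb (T q .zb (Tinv q .z f)))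
          + X .z * minusV q (D q .zb (T q .zb (Tinv q .z f))))) := by
  rw [maxwellMinus_eq]; rfl

/-- The relation `b c = q⁻¹ a d` merges the two mixed terms into `-(q⁻¹ ρ + σ) Q a d`, after which
only the scalar condition `h` remains. In `quadratic_match_high` they merge instead into `-(ρ + q σ)
Q b c`. -/
theorem quadratic_match_low {A : Type*} [Ring A] [Algebra ℂ A] (hq₀ : q ≠ 0) (hq : NonRoot q)
    {a b c d x y : A} {κ ρ σ τ : ℂ} (hx : c * x = κ • (d * y)) (hb : b * c = q⁻¹ • (a * d))
    (h : (q + q⁻¹) * κ = -(τ * (q⁻¹ * ρ + σ))) (Q : A) :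
    qInt q 2 • (Q * a * c * x) - τ • (((-ρ) • (Q * b * c) + (-σ) • (Q * a * d)) * y) = 0 := by
  rw [mul_assoc _ c, hx, mul_assoc Q b, hb, qInt_two hq₀ hq]
  simp only [mul_smul_comm, smul_mul_assoc, add_mul, smul_add, smul_smul, mul_assoc, h]
  module

theorem quadratic_match_high {A : Type*} [Ring A] [Algebra ℂ A] (hq₀ : q ≠ 0) (hq : NonRoot q)
    {a b c d x y : A} {κ ρ σ μ ν : ℂ} (hx : c * x = κ • (d * y)) (hb : b * c = q⁻¹ • (a * d))
    (h : μ * (ρ + q * σ) * κ = -(ν * (q + q⁻¹) * (ρ * σ))) (Q : A) :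
    μ • (((-ρ) • (Q * b * c) + (-σ) • (Q * a * d)) * x)
      - (ν * qInt q 2) • ((ρ * σ) • (Q * b * d) * y) = 0 := by
  have hb' : a * d = q • (b * c) := by rw [hb, smul_smul, mul_inv_cancel₀ hq₀, one_smul]
  rw [qInt_two hq₀ hq, mul_assoc Q a, hb']
  simp only [mul_smul_comm, smul_mul_assoc, add_mul, mul_assoc, hx]
  simp only [smul_smul, ← mul_assoc, ← add_smul, ← sub_smul]
  convert zero_smul ℂ _ using 2
  linear_combination -h

/-- On `1, z, z²` the factor `[2 - N_z]_q` takes the values `[2]_q, 1, 0`, while `D̂_z` produces `0,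
1, [2]_q z`. Degree two in `z` therefore drops out, and one bracket remains for each of `1, z, z̄, z
z̄`. -/
theorem maxwellPlus_quadratic (hq₀ : q ≠ 0) (hq : NonRoot q) {f₀ f₁ f₂ : Field q}
    (h₀ : FreeOf .z f₀) (h₁ : FreeOf .z f₁) (h₂ : FreeOf .z f₂) :
    maxwellPlus q 0 (f₀ + X .z * f₁ + X .z * (X .z * f₂))
      = (1 / 2 * q) • ((qInt q 2 • plusV q f₀ - q ^ 2 • plusM q f₁)
          + X .z * (plusV q f₁ - (q ^ 2 * qInt q 2) • plusM q f₂)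
          + X .zb * ((qInt q 2 • plusP q f₀ - q ^ 2 • plusB q f₁)
          + X .z * (plusP q f₁ - (q ^ 2 * qInt q 2) • plusB q f₂))) := by
  have hN : qIntSub q 2 .z (f₀ + X .z * f₁ + X .z * (X .z * f₂))
      = qInt q 2 • f₀ + X .z * f₁ := by
    rw [map_add, map_add, qIntSub, diagOp_X_mul, diagOp_X_mul, diagOp_X_mul,
      diagOp_of_freeOf h₀ (a := qInt q 2) (by simp +contextual),
      diagOp_of_freeOf h₁ (a := 1) (by simp +contextual [qInt_one hq₀ hq]),
      diagOp_of_freeOf h₂ (a := 0) (by simp +contextual [qInt_zero])]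
    · simp
  have hD : D q .z (f₀ + X .z * f₁ + X .z * (X .z * f₂)) = f₁ + qInt q 2 • (X .z * f₂) := by
    rw [map_add, map_add, D_of_freeOf h₀, D_X_mul_of_freeOf hq₀ hq h₁, D_X_mul_X_mul_of_freeOf h₂,
      zero_add]
  have hz : ∀ κ, Var.z ≠ .x κ := by simp
  rw [maxwellPlus_apply, hN, hD]
  simp only [map_add, map_smul, map_X_mul hz commutesLeft_plusV, map_X_mul hz commutesLeft_plusP,
    map_X_mul hz commutesLeft_plusM, map_X_mul hz commutesLeft_plusB]
  simp only [mul_add, mul_sub, mul_smul_comm, smul_add, smul_sub, smul_smul]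
  module

/-- Compared with the plus case, `T_z̄` weights `f₁` by `q` and `f₂` by `q²`, which combine with the
prefactor `q⁻²` to `q⁻¹` and `1`. Independence of `z` makes `T_z⁻¹` act trivially. -/
theorem maxwellMinus_quadratic (hq₀ : q ≠ 0) (hq : NonRoot q) {f₀ f₁ f₂ : Field q}
    (h₀ : FreeOf .zb f₀) (h₁ : FreeOf .zb f₁) (h₂ : FreeOf .zb f₂)
    (h₀' : FreeOf .z f₀) (h₁' : FreeOf .z f₁) (h₂' : FreeOf .z f₂) :
    maxwellMinus q 0 (f₀ + X .zb * f₁ + X .zb * (X .zb * f₂))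
      = (1 / 2 : ℂ) • ((qInt q 2 • minusB q f₀ - q⁻¹ • minusM q f₁)
          + X .zb * (q • minusB q f₁ - qInt q 2 • minusM q f₂)
          + X .z * ((qInt q 2 • minusP q f₀ - q⁻¹ • minusV q f₁)
          + X .zb * (q • minusP q f₁ - qInt q 2 • minusV q f₂))) := by
  have hI : ∀ {f : Field q}, FreeOf .z f → Tinv q .z f = f := fun hf => by
    rw [Tinv_eq, diagOp_of_freeOf hf (a := 1) (by simp +contextual), one_smul]
  have hT : T q .zb (Tinv q .z (f₀ + X .zb * f₁ + X .zb * (X .zb * f₂)))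
      = f₀ + X .zb * (q • f₁) + X .zb * (X .zb * (q ^ 2 • f₂)) := by
    have hc : CommutesLeft (X .zb) (Tinv q .z) :=
      commutesLeft_Tinv (d := Finsupp.single .zb 1) (1 : Mom q) (by simp)
    rw [map_add (Tinv q .z), map_add (Tinv q .z), hc, hc, hc, hI h₀', hI h₁', hI h₂', map_add, map_add, T_eq, diagOp_X_mul,
      diagOp_X_mul, diagOp_X_mul,
      diagOp_of_freeOf h₀ (a := 1) (by simp +contextual),
      diagOp_of_freeOf h₁ (a := q) (by simp +contextual),
      diagOp_of_freeOf h₂ (a := q ^ 2) (by simp +contextual), one_smul]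
  have hs : ∀ {f : Field q} (c : ℂ), FreeOf .zb f → FreeOf .zb (c • f) := fun c hf e he => by
    rw [coeff_const_smul, hf e he, smul_zero]
  have hN : qIntSub q 2 .zb (f₀ + X .zb * (q • f₁) + X .zb * (X .zb * (q ^ 2 • f₂)))
      = qInt q 2 • f₀ + X .zb * (q • f₁) := by
    rw [map_add, map_add, qIntSub, diagOp_X_mul, diagOp_X_mul, diagOp_X_mul,
      diagOp_of_freeOf h₀ (a := qInt q 2) (by simp +contextual),
      diagOp_of_freeOf (hs _ h₁) (a := 1) (by simp +contextual [qInt_one hq₀ hq]),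
      diagOp_of_freeOf (hs _ h₂) (a := 0) (by simp +contextual [qInt_zero])]
    · simp
  have hD : D q .zb (f₀ + X .zb * (q • f₁) + X .zb * (X .zb * (q ^ 2 • f₂)))
      = q • f₁ + qInt q 2 • (X .zb * (q ^ 2 • f₂)) := by
    rw [map_add, map_add, D_of_freeOf h₀, D_X_mul_of_freeOf hq₀ hq (hs _ h₁),
      D_X_mul_X_mul_of_freeOf (hs _ h₂), zero_add]
  have hz : ∀ κ, Var.zb ≠ .x κ := by simp
  rw [maxwellMinus_apply, hT, hN, hD]
  simp only [map_add, map_smul, map_X_mul hz commutesLeft_minusV, map_X_mul hz commutesLeft_minusP,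
    map_X_mul hz commutesLeft_minusM, map_X_mul hz commutesLeft_minusB]
  have e1 : q⁻¹ * q⁻¹ * q = q⁻¹ := by field_simp
  have e2 : q⁻¹ * q⁻¹ * (qInt q 2 * q ^ 2) = qInt q 2 := by field_simp
  simp only [mul_add, mul_sub, mul_smul_comm, smul_add, smul_sub, smul_smul, e1, e2]
  module

theorem maxwellPlus_product (hq₀ : q ≠ 0) (hq : NonRoot q) {n : ℕ} {Q : Field q}
    (hQ : IsMomentum n Q) (s : ℕ) {α γ α' γ' : Dir}
    (hV : k q α' * plusV q (hTilde q s) = (-q ^ 2) • (k q γ' * plusM q (hTilde q s)))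
    (hP : k q α' * plusP q (hTilde q s) = (-q ^ 2) • (k q γ' * plusB q (hTilde q s)))
    (hc : k q γ * k q α' = q⁻¹ • (k q α * k q γ')) :
    maxwellPlus q 0 (Q * (k q α - var q .z * k q γ) * (k q α' - q • (var q .z * k q γ'))
      * hTilde q s) = 0 := by
  have hX : ∀ y : Field q, y * X .z = X .z * y := fun y => (commute_X y _).eq
  have m₀ := (hQ.mul (isMomentum_k α)).mul (isMomentum_k α')
  have m₁ := (((hQ.mul (isMomentum_k γ)).mul (isMomentum_k α')).smul (-1)).add
    (((hQ.mul (isMomentum_k α)).mul (isMomentum_k γ')).smul (-q))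
  have m₂ := ((hQ.mul (isMomentum_k γ)).mul (isMomentum_k γ')).smul (1 * q)
  have := quadratic_expand hX Q (k q α) (k q γ) (k q α') (k q γ') (hTilde q s) 1 q
  rw [one_smul] at this
  rw [var, this, maxwellPlus_quadratic hq₀ hq (m₀.freeOf_mul_hTilde s (.inl rfl))
    (m₁.freeOf_mul_hTilde s (.inl rfl)) (m₂.freeOf_mul_hTilde s (.inl rfl))]
  simp only [m₀.map_mul commutesLeft_plusV, m₁.map_mul commutesLeft_plusV,
    m₀.map_mul commutesLeft_plusP, m₁.map_mul commutesLeft_plusP,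
    m₁.map_mul commutesLeft_plusM, m₂.map_mul commutesLeft_plusM,
    m₁.map_mul commutesLeft_plusB, m₂.map_mul commutesLeft_plusB]
  -- These are the scalar conditions for `κ = -q²`, `ρ = 1`, `σ = q`.
  have e₁ : (q + q⁻¹) * -q ^ 2 = -(q ^ 2 * (q⁻¹ * 1 + q)) := by ring
  have e₂ : 1 * (1 + q * q) * -q ^ 2 = -(q ^ 2 * (q + q⁻¹) * (1 * q)) := by field_simp; ring
  have low₁ := quadratic_match_low hq₀ hq hV hc e₁ Q
  have low₂ := quadratic_match_low hq₀ hq hP hc e₁ Q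
  have high₁ := quadratic_match_high hq₀ hq hV hc e₂ Q
  have high₂ := quadratic_match_high hq₀ hq hP hc e₂ Q
  rw [one_smul] at high₁ high₂
  rw [low₁, low₂, high₁, high₂]
  simp

theorem maxwellMinus_product (hq₀ : q ≠ 0) (hq : NonRoot q) {n : ℕ} {Q : Field q}
    (hQ : IsMomentum n Q) (s : ℕ) {α γ α' γ' : Dir}
    (hB : k q α' * minusB q (hTilde q s) = (-q ^ (s + 2)) • (k q γ' * minusM q (hTilde q s)))
    (hP : k q α' * minusP q (hTilde q s) = (-q ^ (s + 2)) • (k q γ' * minusV q (hTilde q s)))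
    (hc : k q γ * k q α' = q⁻¹ • (k q α * k q γ')) :
    maxwellMinus q 0 (Q * (k q α - q ^ (s + 5) • (var q .zb * k q γ))
      * (k q α' - q ^ (s + 2) • (var q .zb * k q γ')) * hTilde q s) = 0 := by
  have hX : ∀ y : Field q, y * X .zb = X .zb * y := fun y => (commute_X y _).eq
  have m₀ := (hQ.mul (isMomentum_k α)).mul (isMomentum_k α')
  have m₁ := (((hQ.mul (isMomentum_k γ)).mul (isMomentum_k α')).smul (-q ^ (s + 5))).add
    (((hQ.mul (isMomentum_k α)).mul (isMomentum_k γ')).smul (-q ^ (s + 2)))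
  have m₂ := ((hQ.mul (isMomentum_k γ)).mul (isMomentum_k γ')).smul (q ^ (s + 5) * q ^ (s + 2))
  rw [var, quadratic_expand hX, maxwellMinus_quadratic hq₀ hq
    (m₀.freeOf_mul_hTilde s (.inr rfl)) (m₁.freeOf_mul_hTilde s (.inr rfl))
    (m₂.freeOf_mul_hTilde s (.inr rfl)) (m₀.freeOf_mul_hTilde s (.inl rfl))
    (m₁.freeOf_mul_hTilde s (.inl rfl)) (m₂.freeOf_mul_hTilde s (.inl rfl))]
  simp only [m₀.map_mul commutesLeft_minusB, m₁.map_mul commutesLeft_minusB,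
    m₀.map_mul commutesLeft_minusP, m₁.map_mul commutesLeft_minusP,
    m₁.map_mul commutesLeft_minusM, m₂.map_mul commutesLeft_minusM,
    m₁.map_mul commutesLeft_minusV, m₂.map_mul commutesLeft_minusV]
  -- With `κ = -q^(s+2)` the conditions read `q⁻¹ρ + σ = q^(s+4) + q^(s+2)` and `q^(s+3) (ρ + q σ) =
  -- (q + q⁻¹) ρ σ`; the offsets `s + 5` and `s + 2` solve both.
  have e₁ : (q + q⁻¹) * -q ^ (s + 2) = -(q⁻¹ * (q⁻¹ * q ^ (s + 5) + q ^ (s + 2))) := by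
    rw [pow_add, pow_add]; field_simp
  have e₂ : q * (q ^ (s + 5) + q * q ^ (s + 2)) * -q ^ (s + 2)
      = -(1 * (q + q⁻¹) * (q ^ (s + 5) * q ^ (s + 2))) := by
    rw [pow_add, pow_add]; field_simp
  have low₁ := quadratic_match_low hq₀ hq hB hc e₁ Q
  have low₂ := quadratic_match_low hq₀ hq hP hc e₁ Q
  have high₁ := quadratic_match_high hq₀ hq hB hc e₂ Q
  have high₂ := quadratic_match_high hq₀ hq hP hc e₂ Q
  rw [one_mul] at high₁ high₂
  rw [low₁, low₂, high₁, high₂]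
  simp

theorem k_mul_k (κ κ' : Dir) : k q κ * k q κ'
    = monomial (Finsupp.single Var.t 2) (mom q κ * mom q κ') := by
  rw [← pow_one (k q κ), ← pow_one (k q κ'), k_pow, k_pow, monomial_mul_monomial,
    ← Finsupp.single_add, pow_one, pow_one]

theorem k_mul_k_congr {κ κ' μ μ' : Dir} {c : ℂ}
    (h : mom q κ * mom q κ' = c • (mom q μ * mom q μ')) :
    k q κ * k q κ' = c • (k q μ * k q μ') := by
  classical
  ext e
  rw [k_mul_k, k_mul_k, h, coeff_const_smul, coeff_monomial, coeff_monomial, smul_ite, smul_zero]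

/-- The linear factors are built on the pairs `(k_v, k_-)` and `(k_+, k_v̄)`. The compatibility `γ
α' = q⁻¹ α γ'` is a plain commutation relation when a pair is used twice, and the cone relation for
the mixed family. -/
theorem maxwellPlus_coeffPlus_mul (hq₀ : q ≠ 0) (hq : NonRoot q) (m s : ℕ) (c : Constants) :
    maxwellPlus q 0 (coeffPlus q m c * hTilde q s) = 0 := by
  have vp := v_mul_plusP hq₀ hq s
  have pp := p_mul_plusP hq₀ hq s
  have vv := v_mul_plusV hq₀ hq s
  have pv := p_mul_plusV hq₀ hq s
  have hk := fun (κ₁ κ₂ κ₃ : Dir) (n₁ n₂ n₃ : ℕ) => ((isMomentum_k_pow (q := q) κ₁ n₁).mul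
    (isMomentum_k_pow κ₂ n₂)).mul (isMomentum_k_pow κ₃ n₃)
  simp only [coeffPlus, Finset.sum_mul, add_mul, smul_mul_assoc, map_sum, map_add, map_smul]
  refine Finset.sum_eq_zero fun i _ => ?_
  rw [Finset.sum_eq_zero, Finset.sum_eq_zero, maxwellPlus_product hq₀ hq
    ((isMomentum_k_pow _ _).mul (isMomentum_k_pow _ _)) s vv vp, smul_zero, add_zero, add_zero]
  · apply k_mul_k_congr
    rw [p_mul_m, b_mul_v, smul_smul, inv_mul_cancel₀ hq₀, one_smul]
  · intro j _
    rw [maxwellPlus_product hq₀ hq (hk _ _ _ _ _ _) s pv pp, smul_zero]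
    apply k_mul_k_congr
    rw [p_mul_b, smul_smul, inv_mul_cancel₀ hq₀, one_smul]
  · intro j _
    rw [maxwellPlus_product hq₀ hq (hk _ _ _ _ _ _) s vv vp, smul_zero]
    exact k_mul_k_congr m_mul_v

theorem maxwellMinus_coeffMinus_mul (hq₀ : q ≠ 0) (hq : NonRoot q) (m s : ℕ) (c : Constants) :
    maxwellMinus q 0 (coeffMinus q m s c * hTilde q s) = 0 := by
  have bp := b_mul_minusP hq₀ hq s
  have pp := p_mul_minusP hq₀ hq s
  have bb := b_mul_minusB hq₀ hq s
  have pb := p_mul_minusB hq₀ hq s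
  have hk := fun (κ₁ κ₂ κ₃ : Dir) (n₁ n₂ n₃ : ℕ) => ((isMomentum_k_pow (q := q) κ₁ n₁).mul
    (isMomentum_k_pow κ₂ n₂)).mul (isMomentum_k_pow κ₃ n₃)
  simp only [coeffMinus, Finset.sum_mul, add_mul, smul_mul_assoc, map_sum, map_add, map_smul]
  refine Finset.sum_eq_zero fun i _ => ?_
  rw [Finset.sum_eq_zero, Finset.sum_eq_zero, maxwellMinus_product hq₀ hq
    ((isMomentum_k_pow _ _).mul (isMomentum_k_pow _ _)) s pb pp, smul_zero, add_zero, add_zero]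
  · apply k_mul_k_congr
    rw [m_mul_p, b_mul_v]
  · intro j _
    rw [maxwellMinus_product hq₀ hq (hk _ _ _ _ _ _) s pb pp, smul_zero]
    exact k_mul_k_congr (v_mul_p hq₀)
  · intro j _
    rw [maxwellMinus_product hq₀ hq (hk _ _ _ _ _ _) s bb bp, smul_zero]
    exact k_mul_k_congr m_mul_b

end QuadraticSolutions

/-! ### Convergence -/

section Convergence

open MvPowerSeries

variable {q : ℂ}

/-- All the monomials of `f` have degree `d` for the grading `φ`. -/
def Graded (φ : (Var →₀ ℕ) →+ ℕ) (d : ℕ) (f : Field q) : Prop :=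
  ∀ e, coeff e f ≠ 0 → φ e = d

namespace Graded

variable {φ : (Var →₀ ℕ) →+ ℕ} {d d' : ℕ} {f g : Field q}

theorem monomial (e : Var →₀ ℕ) (w : Mom q) : Graded φ (φ e) (monomial e w) := by
  classical
  intro e' h
  rw [coeff_monomial] at h
  by_cases he : e' = e
  · rw [he]
  · rw [if_neg he] at h
    exact absurd rfl h

theorem add (hf : Graded φ d f) (hg : Graded φ d g) : Graded φ d (f + g) := by
  intro e h
  by_cases h' : coeff e f = 0
  · rw [map_add, h', zero_add] at h
    exact hg e h
  · exact hf e h'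

theorem smul (c : ℂ) (hf : Graded φ d f) : Graded φ d (c • f) := by
  intro e h
  apply hf
  rintro h'
  rw [coeff_const_smul, h', smul_zero] at h
  exact h rfl

theorem sub (hf : Graded φ d f) (hg : Graded φ d g) : Graded φ d (f - g) := by
  have h := hf.add (hg.smul (-1))
  rwa [neg_one_smul, ← sub_eq_add_neg] at h

theorem sum {ι : Type*} {S : Finset ι} {F : ι → Field q} (h : ∀ i ∈ S, Graded φ d (F i)) :
    Graded φ d (∑ i ∈ S, F i) := by
  intro e he
  rw [map_sum] at he
  obtain ⟨i, hi, h'⟩ := Finset.exists_ne_zero_of_sum_ne_zero he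
  exact h i hi e h'

theorem mul (hf : Graded φ d f) (hg : Graded φ d' g) : Graded φ (d + d') (f * g) := by
  classical
  intro e he
  rw [coeff_mul] at he
  obtain ⟨p, hp, h'⟩ := Finset.exists_ne_zero_of_sum_ne_zero he
  rw [← Finset.HasAntidiagonal.mem_antidiagonal.1 hp, map_add, hf _ (left_ne_zero_of_mul h'),
    hg _ (right_ne_zero_of_mul h')]

end Graded

/-- The degree in the momenta. -/
def tDeg : (Var →₀ ℕ) →+ ℕ := Finsupp.applyAddHom Var.t

/-- The degree in the coordinates. -/
def xDeg : (Var →₀ ℕ) →+ ℕ :=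
  Finsupp.applyAddHom (.x .b) + Finsupp.applyAddHom (.x .p) + Finsupp.applyAddHom (.x .m)
    + Finsupp.applyAddHom (.x .v)

theorem tDeg_apply (e : Var →₀ ℕ) : tDeg e = e .t := rfl

theorem xDeg_apply (e : Var →₀ ℕ) :
    xDeg e = e (.x .b) + e (.x .p) + e (.x .m) + e (.x .v) := rfl

theorem xDeg_of_isInternal {e : Var →₀ ℕ} (h : IsInternal e) : xDeg e = 0 := by
  simp [xDeg_apply, h _]

theorem graded_tDeg_hTilde (s : ℕ) : Graded tDeg s (hTilde q s) := by
  intro e h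
  rw [coeff_hTilde] at h
  by_contra h'
  rw [if_neg fun hw => h' hw.2.2.1] at h
  exact h rfl

theorem graded_xDeg_hTilde (s : ℕ) : Graded xDeg s (hTilde q s) := by
  intro e h
  rw [coeff_hTilde] at h
  by_contra h'
  rw [if_neg fun hw => h' hw.2.2.2] at h
  exact h rfl

theorem IsMomentum.graded_tDeg {d : ℕ} {u : Field q} (h : IsMomentum d u) : Graded tDeg d u := by
  obtain ⟨w, rfl⟩ := h
  simpa [tDeg_apply] using Graded.monomial (φ := tDeg) (Finsupp.single Var.t d) w

theorem IsMomentum.graded_xDeg {d : ℕ} {u : Field q} (h : IsMomentum d u) : Graded xDeg 0 u := by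
  obtain ⟨w, rfl⟩ := h
  simpa [xDeg_of_isInternal (isInternal_t d)] using
    Graded.monomial (φ := xDeg) (Finsupp.single Var.t d) w

theorem graded_quadratic {φ : (Var →₀ ℕ) →+ ℕ} {d n : ℕ} {Q a b c d' : Field q} {κ : Var}
    (hκ : φ (Finsupp.single κ 1) = 0) (hQ : Graded φ n Q) (ha : Graded φ d a) (hb : Graded φ d b)
    (hc : Graded φ d c) (hd : Graded φ d d') (ρ σ : ℂ) :
    Graded φ (n + d + d) (Q * (a - ρ • (var q κ * b)) * (c - σ • (var q κ * d'))) := by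
  have hX : Graded φ 0 (var q κ) := hκ ▸ Graded.monomial (Finsupp.single κ 1) 1
  have hb' := (hX.mul hb).smul ρ
  have hd' := (hX.mul hd).smul σ
  rw [zero_add] at hb' hd'
  exact (hQ.mul (ha.sub hb')).mul (hc.sub hd')

/-- The weight `d` of a momentum is a parameter: `d = 1` gives the momentum degree and `d = 0` the
coordinate degree. -/
theorem graded_coeffPlus {φ : (Var →₀ ℕ) →+ ℕ} {d : ℕ} (hz : φ (Finsupp.single .z 1) = 0)
    (hk : ∀ {n : ℕ} {u : Field q}, IsMomentum n u → Graded φ (n * d) u) (m : ℕ) (c : Constants) :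
    Graded φ ((m + 2) * d) (coeffPlus q m c) := by
  have h3 := fun (κ₁ κ₂ κ₃ : Dir) (n₁ n₂ n₃ : ℕ) => hk (((isMomentum_k_pow (q := q) κ₁ n₁).mul
    (isMomentum_k_pow κ₂ n₂)).mul (isMomentum_k_pow κ₃ n₃))
  have h2 := fun (κ₁ κ₂ : Dir) (n₁ n₂ : ℕ) => hk ((isMomentum_k_pow (q := q) κ₁ n₁).mul
    (isMomentum_k_pow κ₂ n₂))
  have h1 := fun κ : Dir => hk (isMomentum_k (q := q) κ)
  refine Graded.sum fun i hi => ((Graded.sum fun j hj => Graded.smul _ ?_).add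
    (Graded.smul _ ?_)).add (Graded.sum fun j hj => Graded.smul _ ?_)
  · have := graded_quadratic hz (h3 .b .m .v i (m - i - j) j) (h1 .v) (h1 .m) (h1 .v) (h1 .m) 1 q
    rw [one_smul] at this
    convert this using 1
    simp only [Finset.mem_range] at hi hj
    rw [← add_mul, ← add_mul]
    congr 1
    omega
  · have := graded_quadratic hz (h2 .b .v i (m - i)) (h1 .p) (h1 .b) (h1 .v) (h1 .m) 1 q
    rw [one_smul] at this
    convert this using 1
    simp only [Finset.mem_range] at hi
    rw [← add_mul, ← add_mul]
    congr 1
    omega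
  · have := graded_quadratic hz (h3 .b .p .v i (m - i - j) j) (h1 .p) (h1 .b) (h1 .p) (h1 .b) 1 q
    rw [one_smul] at this
    convert this using 1
    simp only [Finset.mem_range] at hi hj
    rw [← add_mul, ← add_mul]
    congr 1
    omega

theorem graded_coeffMinus {φ : (Var →₀ ℕ) →+ ℕ} {d : ℕ} (hz : φ (Finsupp.single .zb 1) = 0)
    (hk : ∀ {n : ℕ} {u : Field q}, IsMomentum n u → Graded φ (n * d) u) (m s : ℕ)
    (c : Constants) : Graded φ ((m + 2) * d) (coeffMinus q m s c) := by
  have h3 := fun (κ₁ κ₂ κ₃ : Dir) (n₁ n₂ n₃ : ℕ) => hk (((isMomentum_k_pow (q := q) κ₁ n₁).mul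
    (isMomentum_k_pow κ₂ n₂)).mul (isMomentum_k_pow κ₃ n₃))
  have h2 := fun (κ₁ κ₂ : Dir) (n₁ n₂ : ℕ) => hk ((isMomentum_k_pow (q := q) κ₁ n₁).mul
    (isMomentum_k_pow κ₂ n₂))
  have h1 := fun κ : Dir => hk (isMomentum_k (q := q) κ)
  refine Graded.sum fun i hi => ((Graded.sum fun j hj => Graded.smul _ ?_).add
    (Graded.smul _ ?_)).add (Graded.sum fun j hj => Graded.smul _ ?_)
  · convert graded_quadratic hz (h3 .b .m .v i (m - i - j) j) (h1 .b) (h1 .m) (h1 .b) (h1 .m) _ _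
      using 1
    simp only [Finset.mem_range] at hi hj
    rw [← add_mul, ← add_mul]
    congr 1
    omega
  · convert graded_quadratic hz (h2 .v .b i (m - i)) (h1 .b) (h1 .m) (h1 .p) (h1 .v) _ _ using 1
    simp only [Finset.mem_range] at hi
    rw [← add_mul, ← add_mul]
    congr 1
    omega
  · convert graded_quadratic hz (h3 .v .p .b i (m - i - j) j) (h1 .p) (h1 .v) (h1 .p) (h1 .v) _ _
      using 1
    simp only [Finset.mem_range] at hi hj
    rw [← add_mul, ← add_mul]
    congr 1
    omega

theorem graded_tDeg_coeffPlus (m : ℕ) (c : Constants) :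
    Graded tDeg (m + 2) (coeffPlus q m c) := by
  simpa using graded_coeffPlus (d := 1) (by simp [tDeg_apply])
    (fun h => by simpa using h.graded_tDeg) m c

theorem graded_xDeg_coeffPlus (m : ℕ) (c : Constants) : Graded xDeg 0 (coeffPlus q m c) := by
  simpa using graded_coeffPlus (d := 0) (by simp [xDeg_apply])
    (fun h => by simpa using h.graded_xDeg) m c

theorem graded_tDeg_coeffMinus (m s : ℕ) (c : Constants) :
    Graded tDeg (m + 2) (coeffMinus q m s c) := by
  simpa using graded_coeffMinus (d := 1) (by simp [tDeg_apply])
    (fun h => by simpa using h.graded_tDeg) m s c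

theorem graded_xDeg_coeffMinus (m s : ℕ) (c : Constants) :
    Graded xDeg 0 (coeffMinus q m s c) := by
  simpa using graded_coeffMinus (d := 0) (by simp [xDeg_apply])
    (fun h => by simpa using h.graded_xDeg) m s c

theorem graded_tDeg_termPlus (c : ℕ → ℕ → Constants) (ms : ℕ × ℕ) :
    Graded tDeg (ms.1 + 2 + ms.2) (termPlus q c ms) :=
  ((graded_tDeg_coeffPlus _ _).mul (graded_tDeg_hTilde _)).smul _

theorem graded_xDeg_termPlus (c : ℕ → ℕ → Constants) (ms : ℕ × ℕ) :
    Graded xDeg ms.2 (termPlus q c ms) := by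
  have := ((graded_xDeg_coeffPlus (q := q) ms.1 (c ms.1 ms.2)).mul
    (graded_xDeg_hTilde ms.2)).smul (qFactorial q ms.2)⁻¹
  rwa [zero_add] at this

theorem graded_tDeg_termMinus (c : ℕ → ℕ → Constants) (ms : ℕ × ℕ) :
    Graded tDeg (ms.1 + 2 + ms.2) (termMinus q c ms) :=
  ((graded_tDeg_coeffMinus _ _ _).mul (graded_tDeg_hTilde _)).smul _

theorem graded_xDeg_termMinus (c : ℕ → ℕ → Constants) (ms : ℕ × ℕ) :
    Graded xDeg ms.2 (termMinus q c ms) := by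
  have := ((graded_xDeg_coeffMinus (q := q) ms.1 ms.2 (c ms.1 ms.2)).mul
    (graded_xDeg_hTilde ms.2)).smul (qFactorial q ms.2)⁻¹
  rwa [zero_add] at this

/-- A fixed coefficient sees only the terms of one degree, and these are finitely many. -/
theorem summable_of_graded {ι : Type*} {φ : (Var →₀ ℕ) →+ ℕ} {d : ι → ℕ} {F : ι → Field q}
    (hF : ∀ i, Graded φ (d i) (F i)) (hd : ∀ n, {i | d i = n}.Finite) : Summable F := by
  rw [WithPiTopology.summable_iff_summable_coeff]
  intro e
  refine summable_of_hasFiniteSupport ((hd (φ e)).subset fun i hi => ?_)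
  exact (hF i e hi).symm

theorem finite_degree (n : ℕ) : {ms : ℕ × ℕ | ms.1 + 2 + ms.2 = n}.Finite :=
  ((Finset.range (n + 1) ×ˢ Finset.range (n + 1)).finite_toSet).subset fun ms h => by
    simp only [Set.mem_ofPred_eq] at h
    simp only [Finset.coe_product, Finset.coe_range, Set.mem_prod, Set.mem_Iio]
    omega

theorem summable_termPlus (c : ℕ → ℕ → Constants) : Summable (termPlus q c) :=
  summable_of_graded (graded_tDeg_termPlus c) finite_degree

theorem summable_termMinus (c : ℕ → ℕ → Constants) : Summable (termMinus q c) :=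
  summable_of_graded (graded_tDeg_termMinus c) finite_degree

theorem summable_hTilde : Summable fun s : ℕ => (qFactorial q s)⁻¹ • hTilde q s :=
  summable_of_graded (fun s => (graded_tDeg_hTilde s).smul _) fun n => Set.finite_singleton n

theorem summable_coeffPlus (c : ℕ → Constants) : Summable fun m : ℕ => coeffPlus q m (c m) :=
  summable_of_graded (fun m => graded_tDeg_coeffPlus m _) fun n =>
    (Set.finite_Iic n).subset fun m h => by
      simp only [Set.mem_ofPred_eq] at h
      simp only [Set.mem_Iic]
      omega

/-! #### Continuity of the operators -/

/-- Each coefficient of the image depends on a single coefficient of the argument, and `Mom q` is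
discrete. -/
theorem continuous_diagOp (c : (Var →₀ ℕ) → ℂ) : Continuous (diagOp q c) :=
  continuous_pi fun e =>
    (continuous_of_discreteTopology (f := fun w : Mom q => c e • w)).comp
      (WithPiTopology.continuous_coeff (Mom q) e)

theorem continuous_D (κ : Var) : Continuous (D q κ) :=
  continuous_pi fun e =>
    (continuous_of_discreteTopology (f := fun w : Mom q => qInt q ((e κ : ℤ) + 1) • w)).comp
      (WithPiTopology.continuous_coeff (Mom q) (e + Finsupp.single κ 1))

theorem continuous_M (κ : Var) : Continuous (M q κ) :=
  continuous_const.mul continuous_id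

theorem continuous_mul_end {A B : Module.End ℂ (Field q)} (hA : Continuous A)
    (hB : Continuous B) : Continuous (A * B : Module.End ℂ (Field q)) := hA.comp hB

theorem continuous_add_end {A B : Module.End ℂ (Field q)} (hA : Continuous A)
    (hB : Continuous B) : Continuous (A + B : Module.End ℂ (Field q)) := hA.add hB

theorem continuous_smul_end {A : Module.End ℂ (Field q)} (c : ℂ) (hA : Continuous A) :
    Continuous (c • A : Module.End ℂ (Field q)) := (continuous_diagOp fun _ => c).comp hA

theorem continuous_sub_end {A B : Module.End ℂ (Field q)} (hA : Continuous A)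
    (hB : Continuous B) : Continuous (A - B : Module.End ℂ (Field q)) := hA.sub hB

theorem continuous_maxwellPlus (n : ℤ) : Continuous (maxwellPlus q n) := by
  unfold maxwellPlus
  repeat' with_reducible first
    | apply continuous_sub_end | apply continuous_add_end | apply continuous_smul_end
    | apply continuous_mul_end | apply continuous_M | apply continuous_D
  all_goals exact continuous_diagOp _

theorem continuous_maxwellMinus (n : ℤ) : Continuous (maxwellMinus q n) := by
  unfold maxwellMinus
  repeat' with_reducible first
    | apply continuous_sub_end | apply continuous_add_end | apply continuous_smul_end
    | apply continuous_mul_end | apply continuous_M | apply continuous_D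
  all_goals exact continuous_diagOp _

theorem map_tsum_eq_zero {ι : Type*} {A : Module.End ℂ (Field q)} (hA : Continuous A)
    {F : ι → Field q} (hF : Summable F) (h : ∀ i, A (F i) = 0) : A (∑' i, F i) = 0 := by
  have := hF.hasSum.map A hA
  rw [show A ∘ F = fun _ => 0 from funext h] at this
  exact this.unique hasSum_zero

theorem maxwellPlus_fieldPlus (hq₀ : q ≠ 0) (hq : NonRoot q) (c : ℕ → ℕ → Constants) :
    maxwellPlus q 0 (fieldPlus q c) = 0 :=
  map_tsum_eq_zero (continuous_maxwellPlus 0) (summable_termPlus c) fun ms => by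
    rw [termPlus, map_smul, maxwellPlus_coeffPlus_mul hq₀ hq, smul_zero]

theorem maxwellMinus_fieldMinus (hq₀ : q ≠ 0) (hq : NonRoot q) (c : ℕ → ℕ → Constants) :
    maxwellMinus q 0 (fieldMinus q c) = 0 :=
  map_tsum_eq_zero (continuous_maxwellMinus 0) (summable_termMinus c) fun ms => by
    rw [termMinus, map_smul, maxwellMinus_coeffMinus_mul hq₀ hq, smul_zero]

/-! #### Factorization of the solutions -/

/-- Summing a double series iteratively requires regularity, which a product of discrete spaces has.
-/
theorem regularSpace_field : RegularSpace (Field q) :=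
  inferInstanceAs (RegularSpace ((Var →₀ ℕ) → Mom q))

/-- Since the coefficient is the same for all `s`, the inner sum over `s` is a left multiple of the
plane wave series. -/
theorem hasSum_coeffPlus_mul_expTilde (c : ℕ → Constants) :
    HasSum (fun m : ℕ => coeffPlus q m (c m) * expTilde q) (fieldPlus q fun m _ => c m) := by
  have := regularSpace_field (q := q)
  refine (summable_termPlus fun m _ => c m).hasSum.prod_fiberwise fun m => ?_
  have h := (summable_hTilde (q := q)).hasSum.mul_left (coeffPlus q m (c m))
  simp only [mul_smul_comm] at h
  exact h

theorem fieldPlus_eq_mul_expTilde (c : ℕ → Constants) :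
    fieldPlus q (fun m _ => c m) = (∑' m : ℕ, coeffPlus q m (c m)) * expTilde q :=
  (hasSum_coeffPlus_mul_expTilde c).unique ((summable_coeffPlus c).hasSum.mul_right _)

end Convergence

/-! ### Independence of the constants -/

section Independence

open MvPowerSeries

variable {q : ℂ}

/-- The weighted translation `f ↦ (x ↦ c x * f (x - d))` of functions on a lattice. -/
def shiftOp (c : ℤ × ℤ × ℤ → ℂ) (d : ℤ × ℤ × ℤ) : Module.End ℂ (ℤ × ℤ × ℤ → ℂ) where
  toFun f := fun x => c x * f (x - d)
  map_add' f g := by funext x; simp [mul_add]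
  map_smul' a f := by funext x; simp [mul_left_comm]

theorem shiftOp_mul (c c' : ℤ × ℤ × ℤ → ℂ) (d d' : ℤ × ℤ × ℤ) :
    shiftOp c d * shiftOp c' d' = shiftOp (fun x => c x * c' (x - d)) (d + d') := by
  ext f : 1
  funext x
  simp [shiftOp, sub_sub, mul_assoc]

theorem smul_shiftOp (a : ℂ) (c : ℤ × ℤ × ℤ → ℂ) (d : ℤ × ℤ × ℤ) :
    a • shiftOp c d = shiftOp (fun x => a * c x) d := by
  ext f : 1
  funext x
  simp [shiftOp, mul_assoc]

theorem shiftOp_congr {c c' : ℤ × ℤ × ℤ → ℂ} (h : ∀ x, c x = c' x) (d : ℤ × ℤ × ℤ) :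
    shiftOp c d = shiftOp c' d := by rw [funext h]

/-- The weights by which the momenta act on the functions on `ℤ³`. -/
def momWeight (q : ℂ) : Dir → ℤ × ℤ × ℤ → ℂ
  | .v, _ => 1
  | .b, _ => 1
  | .p, x => q ^ (x.1 + x.2.1)
  | .m, x => q ^ (1 - x.1 - x.2.1)

/-- The translations by which the momenta act on the functions on `ℤ³`. -/
def momShift : Dir → ℤ × ℤ × ℤ
  | .v => (1, 0, 0)
  | .b => (0, 1, 0)
  | .p => (0, 0, 1)
  | .m => (1, 1, -1)

/-- The action of the free algebra on the functions on `ℤ³`. -/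
def freeRep (q : ℂ) : FreeAlgebra ℂ Dir →ₐ[ℂ] Module.End ℂ (ℤ × ℤ × ℤ → ℂ) :=
  FreeAlgebra.lift ℂ fun κ => shiftOp (momWeight q κ) (momShift κ)

theorem freeRep_freeMom (κ : Dir) :
    freeRep q (freeMom κ) = shiftOp (momWeight q κ) (momShift κ) :=
  FreeAlgebra.lift_ι_apply _ _

/-- The translations of `k_+` and `k_-` add up to those of `k_v` and `k_v̄`, as the cone requires.
The weights depend on the sum of the first two coordinates, which `k_v` and `k_v̄` raise by one;
this yields the powers of q in the commutation relations. -/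
theorem freeRep_rel (hq₀ : q ≠ 0) {x y : FreeAlgebra ℂ Dir} (h : MomRel q x y) :
    freeRep q x = freeRep q y := by
  have key : freeRep q (freeMom .p * freeMom .m) = q • freeRep q (freeMom .v * freeMom .b) := by
    simp only [map_mul, freeRep_freeMom, shiftOp_mul, smul_shiftOp]
    refine shiftOp_congr (fun x => ?_) _
    simp only [momWeight, momShift, Prod.fst_sub, Prod.snd_sub]
    rw [← zpow_add₀ hq₀]
    ring_nf
    simp
  have key' : freeRep q (freeMom .m * freeMom .p)
      = q⁻¹ • freeRep q (freeMom .v * freeMom .b) := by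
    simp only [map_mul, freeRep_freeMom, shiftOp_mul, smul_shiftOp]
    refine shiftOp_congr (fun x => ?_) _
    simp only [momWeight, momShift, Prod.fst_sub, Prod.snd_sub]
    rw [← zpow_add₀ hq₀]
    ring_nf
    simp
  cases h with
  | plus_v =>
    simp only [map_mul, map_smul, freeRep_freeMom, shiftOp_mul, smul_shiftOp]
    refine shiftOp_congr (fun x => ?_) _
    simp only [momWeight, momShift, Prod.fst_sub, Prod.snd_sub]
    rw [mul_one, one_mul, ← zpow_one_add₀ hq₀]
    ring_nf
  | minus_v =>
    simp only [map_mul, map_smul, freeRep_freeMom, shiftOp_mul, smul_shiftOp]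
    refine shiftOp_congr (fun x => ?_) _
    simp only [momWeight, momShift, Prod.fst_sub, Prod.snd_sub]
    rw [mul_one, one_mul, ← zpow_neg_one, ← zpow_add₀ hq₀]
    ring_nf
  | plus_b =>
    simp only [map_mul, map_smul, freeRep_freeMom, shiftOp_mul, smul_shiftOp]
    refine shiftOp_congr (fun x => ?_) _
    simp only [momWeight, momShift, Prod.fst_sub, Prod.snd_sub]
    rw [mul_one, one_mul, ← zpow_one_add₀ hq₀]
    ring_nf
  | minus_b =>
    simp only [map_mul, map_smul, freeRep_freeMom, shiftOp_mul, smul_shiftOp]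
    refine shiftOp_congr (fun x => ?_) _
    simp only [momWeight, momShift, Prod.fst_sub, Prod.snd_sub]
    rw [mul_one, one_mul, ← zpow_neg_one, ← zpow_add₀ hq₀]
    ring_nf
  | plus_minus =>
    rw [map_sub, key, key', map_smul, lam]
    module
  | b_v =>
    simp only [map_mul, freeRep_freeMom, shiftOp_mul]
    rfl
  | cone =>
    rw [map_sub, key, map_smul, sub_self, map_zero]

/-- The action of the momenta on the functions on `ℤ³`. -/
def rep (hq₀ : q ≠ 0) : Mom q →ₐ[ℂ] Module.End ℂ (ℤ × ℤ × ℤ → ℂ) :=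
  RingQuot.liftAlgHom ℂ ⟨freeRep q, fun _ _ h => freeRep_rel hq₀ h⟩

theorem rep_mom (hq₀ : q ≠ 0) (κ : Dir) :
    rep hq₀ (mom q κ) = shiftOp (momWeight q κ) (momShift κ) := by
  rw [rep, mom, RingQuot.liftAlgHom_mkAlgHom_apply, freeRep_freeMom]

/-- The momentum `w` acts by a translation by `d` with nonzero weights. -/
def IsShift (hq₀ : q ≠ 0) (d : ℤ × ℤ × ℤ) (w : Mom q) : Prop :=
  ∃ c, (∀ x, c x ≠ 0) ∧ rep hq₀ w = shiftOp c d

theorem isShift_mom (hq₀ : q ≠ 0) (κ : Dir) : IsShift hq₀ (momShift κ) (mom q κ) := by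
  refine ⟨_, fun x => ?_, rep_mom hq₀ κ⟩
  cases κ <;> simp [momWeight, zpow_ne_zero, hq₀]

theorem IsShift.mul {hq₀ : q ≠ 0} {d d' : ℤ × ℤ × ℤ} {w w' : Mom q} (h : IsShift hq₀ d w)
    (h' : IsShift hq₀ d' w') : IsShift hq₀ (d + d') (w * w') := by
  obtain ⟨c, hc, e⟩ := h
  obtain ⟨c', hc', e'⟩ := h'
  exact ⟨_, fun x => mul_ne_zero (hc x) (hc' _), by rw [map_mul, e, e', shiftOp_mul]⟩

theorem isShift_mom_pow (hq₀ : q ≠ 0) (κ : Dir) (n : ℕ) :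
    IsShift hq₀ (n • momShift κ) (mom q κ ^ n) := by
  induction n with
  | zero =>
    refine ⟨fun _ => 1, fun _ => one_ne_zero, ?_⟩
    rw [pow_zero, map_one]
    ext f : 1
    funext x
    simp [shiftOp]
  | succ n ih =>
    rw [pow_succ, succ_nsmul]
    exact ih.mul (isShift_mom hq₀ κ)

/-- The value at `d` of the image of the delta function at the origin. -/
def symbolAt (hq₀ : q ≠ 0) (d : ℤ × ℤ × ℤ) : Mom q →ₗ[ℂ] ℂ where
  toFun w := rep hq₀ w (Pi.single 0 1) d
  map_add' w w' := by simp
  map_smul' a w := by simp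

theorem IsShift.symbolAt_ne_zero {hq₀ : q ≠ 0} {d : ℤ × ℤ × ℤ} {w : Mom q}
    (h : IsShift hq₀ d w) : symbolAt hq₀ d w ≠ 0 := by
  obtain ⟨c, hc, e⟩ := h
  change rep hq₀ w (Pi.single 0 1) d ≠ 0
  rw [e]
  simp [shiftOp, hc]

theorem IsShift.symbolAt_eq_zero {hq₀ : q ≠ 0} {d d' : ℤ × ℤ × ℤ} {w : Mom q}
    (h : IsShift hq₀ d w) (hd : d ≠ d') : symbolAt hq₀ d' w = 0 := by
  obtain ⟨c, hc, e⟩ := h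
  change rep hq₀ w (Pi.single 0 1) d' = 0
  rw [e]
  simp [shiftOp, sub_eq_zero, hd.symm]

/-- The combination of three families of momenta with the given constants. -/
def combine (m : ℕ) (W₁ : ℕ → ℕ → Mom q) (W₂ : ℕ → Mom q) (W₃ : ℕ → ℕ → Mom q)
    (c : Constants) : Mom q :=
  ∑ i ∈ Finset.range (m + 1), ((∑ j ∈ Finset.range (m - i + 1), c.c₁ i j • W₁ i j)
    + c.c₂ i • W₂ i + ∑ j ∈ Finset.range (m - i + 1), c.c₃ i j • W₃ i j)

theorem map_combine (m : ℕ) (W₁ : ℕ → ℕ → Mom q) (W₂ : ℕ → Mom q) (W₃ : ℕ → ℕ → Mom q)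
    (c : Constants) (L : Mom q →ₗ[ℂ] ℂ) :
    L (combine m W₁ W₂ W₃ c)
      = ∑ i ∈ Finset.range (m + 1), ∑ j ∈ Finset.range (m - i + 1), c.c₁ i j * L (W₁ i j)
        + ∑ i ∈ Finset.range (m + 1), c.c₂ i * L (W₂ i)
        + ∑ i ∈ Finset.range (m + 1), ∑ j ∈ Finset.range (m - i + 1), c.c₃ i j * L (W₃ i j) := by
  simp only [combine, map_sum, map_add, map_smul, Finset.sum_add_distrib, smul_eq_mul]

theorem sum_sum_range_eq_single {m i₀ j₀ : ℕ} (h₀ : i₀ + j₀ ≤ m) (F : ℕ → ℕ → ℂ)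
    (hF : ∀ i j, i + j ≤ m → ¬ (i = i₀ ∧ j = j₀) → F i j = 0) :
    ∑ i ∈ Finset.range (m + 1), ∑ j ∈ Finset.range (m - i + 1), F i j = F i₀ j₀ := by
  rw [Finset.sum_eq_single i₀, Finset.sum_eq_single j₀]
  · intro j hj hne
    rw [Finset.mem_range] at hj
    exact hF _ _ (by omega) fun h => hne h.2
  · intro h
    rw [Finset.mem_range] at h
    omega
  · intro i hi hne
    refine Finset.sum_eq_zero fun j hj => ?_
    rw [Finset.mem_range] at hi hj
    exact hF _ _ (by omega) fun h => hne h.1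
  · intro h
    rw [Finset.mem_range] at h
    omega

theorem sum_sum_range_eq_zero {m : ℕ} (F : ℕ → ℕ → ℂ) (hF : ∀ i j, i + j ≤ m → F i j = 0) :
    ∑ i ∈ Finset.range (m + 1), ∑ j ∈ Finset.range (m - i + 1), F i j = 0 :=
  Finset.sum_eq_zero fun i hi => Finset.sum_eq_zero fun j hj => by
    rw [Finset.mem_range] at hi hj
    exact hF _ _ (by omega)

/-- Evaluating `symbolAt` at the translation of one word annihilates all the others, because their
translations differ, and reads off its constant up to a nonzero factor. -/
theorem agree_of_combine_eq {hq₀ : q ≠ 0} {m : ℕ} {W₁ : ℕ → ℕ → Mom q} {W₂ : ℕ → Mom q}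
    {W₃ : ℕ → ℕ → Mom q} {D₁ : ℕ → ℕ → ℤ × ℤ × ℤ} {D₂ : ℕ → ℤ × ℤ × ℤ} {D₃ : ℕ → ℕ → ℤ × ℤ × ℤ}
    (h₁ : ∀ i j, i + j ≤ m → IsShift hq₀ (D₁ i j) (W₁ i j))
    (h₂ : ∀ i, i ≤ m → IsShift hq₀ (D₂ i) (W₂ i))
    (h₃ : ∀ i j, i + j ≤ m → IsShift hq₀ (D₃ i j) (W₃ i j))
    (h₁₁ : ∀ i j i' j', i + j ≤ m → i' + j' ≤ m → D₁ i j = D₁ i' j' → i = i' ∧ j = j')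
    (h₂₂ : ∀ i i', i ≤ m → i' ≤ m → D₂ i = D₂ i' → i = i')
    (h₃₃ : ∀ i j i' j', i + j ≤ m → i' + j' ≤ m → D₃ i j = D₃ i' j' → i = i' ∧ j = j')
    (h₁₂ : ∀ i j i', i + j ≤ m → i' ≤ m → D₁ i j ≠ D₂ i')
    (h₁₃ : ∀ i j i' j', i + j ≤ m → i' + j' ≤ m → D₁ i j ≠ D₃ i' j')
    (h₂₃ : ∀ i i' j', i ≤ m → i' + j' ≤ m → D₂ i ≠ D₃ i' j')
    {c c' : Constants} (h : combine m W₁ W₂ W₃ c = combine m W₁ W₂ W₃ c') : c.Agree m c' := by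
  refine ⟨fun i j hij => ?_, fun i hi => ?_, fun i j hij => ?_⟩
  · have key : ∀ c : Constants, symbolAt hq₀ (D₁ i j) (combine m W₁ W₂ W₃ c)
        = c.c₁ i j * symbolAt hq₀ (D₁ i j) (W₁ i j) := fun c => by
      rw [map_combine, sum_sum_range_eq_single hij, sum_sum_range_eq_zero, Finset.sum_eq_zero,
        add_zero, add_zero]
      · intro i' hi'
        rw [Finset.mem_range, Nat.lt_succ_iff] at hi'
        rw [(h₂ i' hi').symbolAt_eq_zero (h₁₂ _ _ _ hij hi').symm, mul_zero]
      · intro i' j' hij'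
        rw [(h₃ _ _ hij').symbolAt_eq_zero (h₁₃ _ _ _ _ hij hij').symm, mul_zero]
      · intro i' j' hij' hne
        rw [(h₁ _ _ hij').symbolAt_eq_zero fun h => hne (h₁₁ _ _ _ _ hij' hij h), mul_zero]
    exact mul_right_cancel₀ (h₁ i j hij).symbolAt_ne_zero (by rw [← key, ← key, h])
  · have key : ∀ c : Constants, symbolAt hq₀ (D₂ i) (combine m W₁ W₂ W₃ c)
        = c.c₂ i * symbolAt hq₀ (D₂ i) (W₂ i) := fun c => by
      rw [map_combine, sum_sum_range_eq_zero, sum_sum_range_eq_zero, Finset.sum_eq_single i,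
        add_zero, zero_add]
      · intro i' hi' hne
        rw [Finset.mem_range, Nat.lt_succ_iff] at hi'
        rw [(h₂ i' hi').symbolAt_eq_zero fun h => hne (h₂₂ _ _ hi' hi h), mul_zero]
      · intro hn
        rw [Finset.mem_range] at hn
        omega
      · intro i' j' hij'
        rw [(h₃ _ _ hij').symbolAt_eq_zero (h₂₃ _ _ _ hi hij').symm, mul_zero]
      · intro i' j' hij'
        rw [(h₁ _ _ hij').symbolAt_eq_zero (h₁₂ _ _ _ hij' hi), mul_zero]
    exact mul_right_cancel₀ (h₂ i hi).symbolAt_ne_zero (by rw [← key, ← key, h])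
  · have key : ∀ c : Constants, symbolAt hq₀ (D₃ i j) (combine m W₁ W₂ W₃ c)
        = c.c₃ i j * symbolAt hq₀ (D₃ i j) (W₃ i j) := fun c => by
      rw [map_combine, sum_sum_range_eq_zero (m := m) (fun i j => c.c₁ i j * _),
        sum_sum_range_eq_single hij, Finset.sum_eq_zero, zero_add, zero_add]
      · intro i' hi'
        rw [Finset.mem_range, Nat.lt_succ_iff] at hi'
        rw [(h₂ i' hi').symbolAt_eq_zero (h₂₃ _ _ _ hi' hij), mul_zero]
      · intro i' j' hij' hne
        rw [(h₃ _ _ hij').symbolAt_eq_zero fun h => hne (h₃₃ _ _ _ _ hij' hij h), mul_zero]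
      · intro i' j' hij'
        rw [(h₁ _ _ hij').symbolAt_eq_zero (h₁₃ _ _ _ _ hij' hij), mul_zero]
    exact mul_right_cancel₀ (h₃ i j hij).symbolAt_ne_zero (by rw [← key, ← key, h])

/-- The exponents of the monomial `v̄^s`, together with degree `n + s` in the momenta. -/
def purePower (s n : ℕ) : Var →₀ ℕ := Finsupp.single (.x .b) s + Finsupp.single .t (n + s)

/-- At the pure power `v̄^s` the word in `h̃_s` is just `k_v^s`. -/
theorem coeff_purePower_momentum_mul_hTilde (s n : ℕ) (w : Mom q) :
    coeff (purePower s n) (monomial (Finsupp.single .t n) w * hTilde q s)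
      = ((invBeta q s)⁻¹ * amp q s 0 0 0) • (w * mom q .v ^ s) := by
  have e : purePower s n = Finsupp.single .t n + purePower s 0 := by
    rw [purePower, purePower, Finsupp.single_add, zero_add]
    abel
  rw [e, coeff_add_monomial_mul, coeff_hTilde, if_pos]
  · simp [purePower, word, smul_smul]
  · simp [IsWaveExponent, purePower]

/-- The exponent contains no spin variable, so only the leading terms of the two linear factors
contribute. -/
theorem coeff_purePower_quadratic {s n n' : ℕ} (hn : n' = n + 2) {Q : Field q} {w : Mom q}
    (hQ : Q = monomial (Finsupp.single .t n) w)
    {κ : Var} (hκ : κ = .z ∨ κ = .zb) (α γ α' γ' : Dir) (ρ σ : ℂ) :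
    coeff (purePower s n') (Q * (k q α - ρ • (var q κ * k q γ))
        * (k q α' - σ • (var q κ * k q γ')) * hTilde q s)
      = ((invBeta q s)⁻¹ * amp q s 0 0 0) • (w * mom q α * mom q α' * mom q .v ^ s) := by
  have h0 : purePower s n' κ = 0 := by
    rcases hκ with rfl | rfl <;> simp [purePower]
  rw [var, quadratic_expand fun y : Field q => (commute_X y κ).eq, map_add, map_add,
    coeff_X_mul_eq_zero _ h0, coeff_X_mul_eq_zero _ h0, add_zero, add_zero, hQ, mul_assoc _ (k q α),
    k_mul_k, monomial_mul_monomial, ← Finsupp.single_add, hn, coeff_purePower_momentum_mul_hTilde,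
    ← mul_assoc]

/-- The coordinate degree fixes `s`, and then the momentum degree `m + 2 + s` fixes `m`. -/
theorem coeff_tsum_single {F : ℕ × ℕ → Field q} (hF : Summable F)
    (ht : ∀ ms, Graded tDeg (ms.1 + 2 + ms.2) (F ms)) (hx : ∀ ms, Graded xDeg ms.2 (F ms))
    (m s : ℕ) :
    coeff (purePower s (m + 2)) (∑' ms, F ms) = coeff (purePower s (m + 2)) (F (m, s)) := by
  refine (WithPiTopology.hasSum_iff_hasSum_coeff.1 hF.hasSum (purePower s (m + 2))).unique
    (hasSum_single (m, s) fun ms hne => ?_)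
  by_contra h
  have h1 := ht ms _ h
  have h2 := hx ms _ h
  simp [tDeg_apply, xDeg_apply, purePower] at h1 h2
  exact hne (Prod.ext (by simp; omega) (by simp; omega))

end Independence

/-! ### Recovery of the constants from the fields. -/

section Determination

open MvPowerSeries

variable {q : ℂ}

theorem k_pow_mul_k_pow (κ₁ κ₂ : Dir) (n₁ n₂ : ℕ) : k q κ₁ ^ n₁ * k q κ₂ ^ n₂
    = monomial (Finsupp.single Var.t (n₁ + n₂)) (mom q κ₁ ^ n₁ * mom q κ₂ ^ n₂) := by
  simp only [k_pow, monomial_mul_monomial, ← Finsupp.single_add]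

theorem k_pow_mul_k_pow_mul_k_pow (κ₁ κ₂ κ₃ : Dir) (n₁ n₂ n₃ : ℕ) :
    k q κ₁ ^ n₁ * k q κ₂ ^ n₂ * k q κ₃ ^ n₃ = monomial (Finsupp.single Var.t (n₁ + n₂ + n₃))
      (mom q κ₁ ^ n₁ * mom q κ₂ ^ n₂ * mom q κ₃ ^ n₃) := by
  simp only [k_pow, monomial_mul_monomial, ← Finsupp.single_add]

theorem coeff_coeffPlus_mul_hTilde (m s : ℕ) (c : Constants) :
    coeff (purePower s (m + 2)) (coeffPlus q m c * hTilde q s)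
      = ((invBeta q s)⁻¹ * amp q s 0 0 0) • combine m
        (fun i j => mom q .b ^ i * mom q .m ^ (m - i - j) * mom q .v ^ j * mom q .v * mom q .v
          * mom q .v ^ s)
        (fun i => mom q .b ^ i * mom q .v ^ (m - i) * mom q .p * mom q .v * mom q .v ^ s)
        (fun i j => mom q .b ^ i * mom q .p ^ (m - i - j) * mom q .v ^ j * mom q .p * mom q .p
          * mom q .v ^ s) c := by
  simp only [coeffPlus, combine, Finset.sum_mul, add_mul, smul_mul_assoc, map_sum, map_add,
    coeff_const_smul, Finset.smul_sum, smul_add]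
  refine Finset.sum_congr rfl fun i hi => ?_
  rw [Finset.mem_range] at hi
  congr 1
  · congr 1
    · refine Finset.sum_congr rfl fun j hj => ?_
      rw [Finset.mem_range] at hj
      have := coeff_purePower_quadratic (q := q) (s := s) (n' := m + 2) (by omega)
        (k_pow_mul_k_pow_mul_k_pow .b .m .v i (m - i - j) j) (.inl rfl) .v .m .v .m 1 q
      rw [one_smul] at this
      rw [this, smul_comm]
    · have := coeff_purePower_quadratic (q := q) (s := s) (n' := m + 2) (by omega)
        (k_pow_mul_k_pow .b .v i (m - i)) (.inl rfl) .p .b .v .m 1 q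
      rw [one_smul] at this
      rw [this, smul_comm]
  · refine Finset.sum_congr rfl fun j hj => ?_
    rw [Finset.mem_range] at hj
    have := coeff_purePower_quadratic (q := q) (s := s) (n' := m + 2) (by omega)
      (k_pow_mul_k_pow_mul_k_pow .b .p .v i (m - i - j) j) (.inl rfl) .p .b .p .b 1 q
    rw [one_smul] at this
    rw [this, smul_comm]

theorem coeff_coeffMinus_mul_hTilde (m s : ℕ) (c : Constants) :
    coeff (purePower s (m + 2)) (coeffMinus q m s c * hTilde q s)
      = ((invBeta q s)⁻¹ * amp q s 0 0 0) • combine m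
        (fun i j => mom q .b ^ i * mom q .m ^ (m - i - j) * mom q .v ^ j * mom q .b * mom q .b
          * mom q .v ^ s)
        (fun i => mom q .v ^ i * mom q .b ^ (m - i) * mom q .b * mom q .p * mom q .v ^ s)
        (fun i j => mom q .v ^ i * mom q .p ^ (m - i - j) * mom q .b ^ j * mom q .p * mom q .p
          * mom q .v ^ s) c := by
  simp only [coeffMinus, combine, Finset.sum_mul, add_mul, smul_mul_assoc, map_sum, map_add,
    coeff_const_smul, Finset.smul_sum, smul_add]
  refine Finset.sum_congr rfl fun i hi => ?_
  rw [Finset.mem_range] at hi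
  congr 1
  · congr 1
    · refine Finset.sum_congr rfl fun j hj => ?_
      rw [Finset.mem_range] at hj
      rw [coeff_purePower_quadratic (n' := m + 2) (by omega)
        (k_pow_mul_k_pow_mul_k_pow .b .m .v i (m - i - j) j) (.inr rfl), smul_comm]
    · rw [coeff_purePower_quadratic (n' := m + 2) (by omega)
        (k_pow_mul_k_pow .v .b i (m - i)) (.inr rfl), smul_comm]
  · refine Finset.sum_congr rfl fun j hj => ?_
    rw [Finset.mem_range] at hj
    rw [coeff_purePower_quadratic (n' := m + 2) (by omega)
      (k_pow_mul_k_pow_mul_k_pow .v .p .b i (m - i - j) j) (.inr rfl), smul_comm]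

/-- If the normalization sum vanished, `h̃_s` would be zero and the constants with this `s` would be
lost. -/
theorem waveFactor_ne_zero (hq₀ : q ≠ 0) (hq : NonRoot q) {s : ℕ} (hs : invBeta q s ≠ 0) :
    (qFactorial q s)⁻¹ * ((invBeta q s)⁻¹ * amp q s 0 0 0) ≠ 0 :=
  mul_ne_zero (inv_ne_zero (qFactorial_ne_zero hq₀ hq s))
    (mul_ne_zero (inv_ne_zero hs) (amp_ne_zero hq₀ hq s 0 0 0))

theorem agree_of_fieldPlus_eq (hq₀ : q ≠ 0) (hq : NonRoot q) {p p' : ℕ → ℕ → Constants}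
    (h : fieldPlus q p = fieldPlus q p') {m s : ℕ} (hs : invBeta q s ≠ 0) :
    (p m s).Agree m (p' m s) := by
  have hc := fun c : ℕ → ℕ → Constants => coeff_tsum_single (q := q) (summable_termPlus c)
    (graded_tDeg_termPlus c) (graded_xDeg_termPlus c) m s
  have h' := congrArg (coeff (purePower s (m + 2))) h
  rw [fieldPlus, fieldPlus, hc, hc, termPlus, termPlus, coeff_const_smul, coeff_const_smul,
    coeff_coeffPlus_mul_hTilde, coeff_coeffPlus_mul_hTilde, smul_smul, smul_smul] at h'
  have h'' := smul_right_injective _ (waveFactor_ne_zero hq₀ hq hs) h'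
  have P := isShift_mom_pow hq₀
  have S := isShift_mom hq₀
  refine agree_of_combine_eq (hq₀ := hq₀)
    (fun i j _ => (((((P .b i).mul (P .m (m - i - j))).mul (P .v j)).mul (S .v)).mul (S .v)).mul
      (P .v s))
    (fun i _ => ((((P .b i).mul (P .v (m - i))).mul (S .p)).mul (S .v)).mul (P .v s))
    (fun i j _ => (((((P .b i).mul (P .p (m - i - j))).mul (P .v j)).mul (S .p)).mul (S .p)).mul
      (P .v s)) ?_ ?_ ?_ ?_ ?_ ?_ h''
  -- The third coordinate of the translation is at most `0` on the first family, `1` on the second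
  -- and at least `2` on the third. Within a family the three coordinates recover the indices.
  all_goals
    intros
    simp only [momShift, Prod.smul_mk, Prod.mk_add_mk, Prod.mk.injEq, ne_eq, nsmul_eq_mul] at *
    omega

theorem agree_of_fieldMinus_eq (hq₀ : q ≠ 0) (hq : NonRoot q) {r r' : ℕ → ℕ → Constants}
    (h : fieldMinus q r = fieldMinus q r') {m s : ℕ} (hs : invBeta q s ≠ 0) :
    (r m s).Agree m (r' m s) := by
  have hc := fun c : ℕ → ℕ → Constants => coeff_tsum_single (q := q) (summable_termMinus c)
    (graded_tDeg_termMinus c) (graded_xDeg_termMinus c) m s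
  have h' := congrArg (coeff (purePower s (m + 2))) h
  rw [fieldMinus, fieldMinus, hc, hc, termMinus, termMinus, coeff_const_smul, coeff_const_smul,
    coeff_coeffMinus_mul_hTilde, coeff_coeffMinus_mul_hTilde, smul_smul, smul_smul] at h'
  have h'' := smul_right_injective _ (waveFactor_ne_zero hq₀ hq hs) h'
  have P := isShift_mom_pow hq₀
  have S := isShift_mom hq₀
  refine agree_of_combine_eq (hq₀ := hq₀)
    (fun i j _ => (((((P .b i).mul (P .m (m - i - j))).mul (P .v j)).mul (S .b)).mul (S .b)).mul
      (P .v s))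
    (fun i _ => ((((P .v i).mul (P .b (m - i))).mul (S .b)).mul (S .p)).mul (P .v s))
    (fun i j _ => (((((P .v i).mul (P .p (m - i - j))).mul (P .b j)).mul (S .p)).mul (S .p)).mul
      (P .v s)) ?_ ?_ ?_ ?_ ?_ ?_ h''
  -- The third coordinate again separates the families, since the leading words contain no, one and
  -- at least two factors `k_+`, respectively.
  all_goals
    intros
    simp only [momShift, Prod.smul_mk, Prod.mk_add_mk, Prod.mk.injEq, ne_eq, nsmul_eq_mul] at *
    omega

end Determination

end QMaxwell

end
open QMaxwell in
theorem mainTheorem3 (q : ℂ) (hq₀ : q ≠ 0) (hq : ∀ n : ℕ, 0 < n → q ^ n = 1 → q = 1) :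
    (∀ p : ℕ → ℕ → Constants,
      Summable (termPlus q p) ∧ maxwellPlus q 0 (fieldPlus q p) = 0) ∧
    (∀ r : ℕ → ℕ → Constants,
      Summable (termMinus q r) ∧ maxwellMinus q 0 (fieldMinus q r) = 0) ∧
    ((∀ s : ℕ, invBeta q s ≠ 0) →
      (∀ p p' : ℕ → ℕ → Constants, fieldPlus q p = fieldPlus q p' →
        ∀ m s : ℕ, (p m s).Agree m (p' m s)) ∧
      (∀ r r' : ℕ → ℕ → Constants, fieldMinus q r = fieldMinus q r' →
        ∀ m s : ℕ, (r m s).Agree m (r' m s))) ∧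
    (∀ p : ℕ → Constants,
      Summable (fun s : ℕ => (qFactorial q s)⁻¹ • hTilde q s) ∧
      Summable (fun m : ℕ => coeffPlus q m (p m)) ∧
      HasSum (fun m : ℕ => coeffPlus q m (p m) * expTilde q) (fieldPlus q fun m _ => p m) ∧
      fieldPlus q (fun m _ => p m) = (∑' m : ℕ, coeffPlus q m (p m)) * expTilde q) :=
  ⟨fun p => ⟨summable_termPlus p, maxwellPlus_fieldPlus hq₀ hq p⟩,
    fun r => ⟨summable_termMinus r, maxwellMinus_fieldMinus hq₀ hq r⟩,
    fun hs => ⟨fun _ _ h _ s => agree_of_fieldPlus_eq hq₀ hq h (hs s),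
      fun _ _ h _ s => agree_of_fieldMinus_eq hq₀ hq h (hs s)⟩,
    fun p => ⟨summable_hTilde, summable_coeffPlus p, hasSum_coeffPlus_mul_expTilde p,
      fieldPlus_eq_mul_expTilde p⟩⟩
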